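/- **Theorem 1.4.** Let $M^n$ be a smooth manifold with a smooth Riemannian metric $g$ and a function $\phi\in C^\infty(M)$; that is, $(M^n,g,\phi,\lambda)$ is a manifold with density with $\lambda=0$. Let $(g_u,\phi_u)$ be a smooth $1$-parameter family of Riemannian metrics and functions on $M$, defined for $(x,u)$ in an open neighbourhood of $M\times\{0\}$ in $M\times\mathbb{R}$, with $(g_0,\phi_0)=(g,\phi)$. Suppose that $$\widetilde g=2\,du\,dv+g_u,\qquad \widetilde\phi=\phi_u-v$$ is a weighted ambient space in normal form for $(M^n,g,\phi,0)$: on a neighbourhood of $\{u=0\}$ in $\mathbb{R}\times M\times\mathbb{R}$, with points $(v,x,u)$, $$\mathrm{Ric}(\widetilde g)+\widetilde\nabla^2\widetilde\phi=O(u^\infty),\qquad \widetilde\Delta\widetilde\phi-|\widetilde\nabla\widetilde\phi|^2_{\widetilde g}=O(u^\infty).$$ Here a function or tensor is $O(u^\infty)$ if it vanishes to infinite order in $u$ at $u=0$. Write $R_u$, $\Delta$, $\nabla_u$ for the scalar curvature, Laplacian and gradient of $g_u$, set $(\mathrm{Ric}_\phi)_u=\mathrm{Ric}(g_u)+\nabla_u^2\phi_u$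 and $(v_{1,\phi})_u=\frac12\left(R_u+2\Delta\phi_u-|\nabla_u\phi_u|^2\right)$, and define the vector field $$X=(v_{1,\phi})_u\,\partial_v-\partial_u .$$ Regard $g_u=(g_u)_{ij}dx^idx^j$ and $(\mathrm{Ric}_\phi)_u$ as $(0,2)$-tensor fields on $\mathbb{R}\times M\times\mathbb{R}$. Then $$L_Xg_u=-2(\mathrm{Ric}_\phi)_u \bmod O(u^\infty),\qquad L_X\widetilde\phi=-(R_u+\Delta\phi_u)\bmod O(u^\infty).$$ In other words, $(g_u,\widetilde\phi)$ is a formal solution of the $\mathcal F$-gradient Ricci flow $\partial_tg=-2\mathrm{Ric}_\phi$, $\partial_t\phi=-R-\Delta\phi$ along $X$. -/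

import Mathlib

open scoped Manifold ContDiff Topology
open Bundle Asymptotics

set_option maxSynthPendingDepth 3

noncomputable section

namespace WeightedAmbient

/-! ### Local (pseudo-)Riemannian geometry

`G : E → E →L[ℝ] E →L[ℝ] ℝ` is the coordinate expression of a (pseudo-)Riemannian metric on a
finite-dimensional real vector space `E`. All formulas only involve the germ of `G` at `y`. -/

section Local

variable {E : Type*} [NormedAddCommGroup E] [NormedSpace ℝ E]

/-- Christoffel symbols of the first kind:
`Γ(a, b; c) = (∂_a G(b, c) + ∂_b G(a, c) - ∂_c G(a, b)) / 2`. -/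
def christoffelFirst (G : E → E →L[ℝ] E →L[ℝ] ℝ) (y : E) : E →L[ℝ] E →L[ℝ] E →L[ℝ] ℝ :=
  let D : E →L[ℝ] E →L[ℝ] E →L[ℝ] ℝ := fderiv ℝ G y
  let S : (E →L[ℝ] E →L[ℝ] ℝ) →L[ℝ] E →L[ℝ] E →L[ℝ] ℝ :=
    (ContinuousLinearMap.flipₗᵢ ℝ E E ℝ).toContinuousLinearEquiv.toContinuousLinearMap
  let D' : E →L[ℝ] E →L[ℝ] E →L[ℝ] ℝ := S ∘L D.flip
  (1 / 2 : ℝ) • (D + D.flip - D')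

theorem christoffelFirst_apply (G : E → E →L[ℝ] E →L[ℝ] ℝ) (y a b c : E) :
    christoffelFirst G y a b c =
      (1 / 2 : ℝ) * (fderiv ℝ G y a b c + fderiv ℝ G y b a c - fderiv ℝ G y c a b) := by
  simp [christoffelFirst]

/-- Raising an index: the inverse of `E → E^*`, `a ↦ A(a, ·)`. -/
def sharp (A : E →L[ℝ] E →L[ℝ] ℝ) : (E →L[ℝ] ℝ) →L[ℝ] E :=
  ContinuousLinearMap.inverse A

/-- Christoffel symbols of the second kind (of the Levi-Civita connection),
`Γ(a, b) = Γ^k_{ij} a^i b^j ∂_k`. -/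
def christoffel (G : E → E →L[ℝ] E →L[ℝ] ℝ) (y : E) : E →L[ℝ] E →L[ℝ] E :=
  (ContinuousLinearMap.compL ℝ E (E →L[ℝ] ℝ) E (sharp (G y))) ∘L christoffelFirst G y

theorem christoffel_apply (G : E → E →L[ℝ] E →L[ℝ] ℝ) (y a b : E) :
    christoffel G y a b = sharp (G y) (christoffelFirst G y a b) := by
  simp [christoffel]

/-- The endomorphism `c ↦ Rm(c, a) b`, where
`Rm(c, a) b = ∇_c ∇_a b - ∇_a ∇_c b` for constant coordinate vectors `a, b, c`. -/
def curvatureEnd (G : E → E →L[ℝ] E →L[ℝ] ℝ) (y a b : E) : E →L[ℝ] E :=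
  ((fderiv ℝ (christoffel G) y).flip a).flip b - (fderiv ℝ (christoffel G) y a).flip b
    + (christoffel G y).flip (christoffel G y a b)
    - (christoffel G y a) ∘L (christoffel G y).flip b

theorem curvatureEnd_apply (G : E → E →L[ℝ] E →L[ℝ] ℝ) (y a b c : E) :
    curvatureEnd G y a b c =
      fderiv ℝ (christoffel G) y c a b - fderiv ℝ (christoffel G) y a c b
        + christoffel G y c (christoffel G y a b) - christoffel G y a (christoffel G y c b) := by
  simp [curvatureEnd]

/-- The Hessian `∇²f(a, b) = ∂_a ∂_b f - df(Γ(a, b))`. -/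
def localHess (G : E → E →L[ℝ] E →L[ℝ] ℝ) (f : E → ℝ) (y : E) : E →L[ℝ] E →L[ℝ] ℝ :=
  fderiv ℝ (fderiv ℝ f) y
    - (ContinuousLinearMap.compL ℝ E E ℝ (fderiv ℝ f y)) ∘L christoffel G y

/-- The squared gradient `|∇f|² = g^{ij} ∂_i f ∂_j f`. -/
def localGradSq (G : E → E →L[ℝ] E →L[ℝ] ℝ) (f : E → ℝ) (y : E) : ℝ :=
  fderiv ℝ f y (sharp (G y) (fderiv ℝ f y))

variable [FiniteDimensional ℝ E]

/-- The Ricci tensor `Ric(a, b) = tr (c ↦ Rm(c, a) b)` (positive on round spheres). -/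
def localRic (G : E → E →L[ℝ] E →L[ℝ] ℝ) (y : E) : E →L[ℝ] E →L[ℝ] ℝ :=
  (LinearMap.mk₂ ℝ (fun a b => LinearMap.trace ℝ E (curvatureEnd G y a b : E →ₗ[ℝ] E))
    (fun a a' b => by
      rw [← map_add]; congr 1; ext c; simp [curvatureEnd_apply]; abel)
    (fun r a b => by
      rw [← map_smul]; congr 1; ext c; simp [curvatureEnd_apply, smul_sub, smul_add])
    (fun a b b' => by
      rw [← map_add]; congr 1; ext c; simp [curvatureEnd_apply]; abel)
    (fun r a b => by
      rw [← map_smul]; congr 1; ext c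
      simp [curvatureEnd_apply, smul_sub, smul_add])).toContinuousBilinearMap

theorem localRic_apply (G : E → E →L[ℝ] E →L[ℝ] ℝ) (y a b : E) :
    localRic G y a b = LinearMap.trace ℝ E (curvatureEnd G y a b : E →ₗ[ℝ] E) := rfl

/-- The trace `g^{ij} B_{ij}` of a bilinear form `B` with respect to the metric `A`. -/
def metricTrace (A B : E →L[ℝ] E →L[ℝ] ℝ) : ℝ :=
  LinearMap.trace ℝ E ((sharp A ∘L B : E →L[ℝ] E) : E →ₗ[ℝ] E)

end Local

/-! ### Tensors on a manifold

`N` is a manifold without boundary with model `I`. A tensor is computed at a point `p` in the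
preferred chart at `p`; Mathlib's tangent space `TangentSpace I p` is the model vector space `E`,
identified with the space of tangent vectors at `p` through this same chart. -/

section Manifold

variable {E : Type*} [NormedAddCommGroup E] [NormedSpace ℝ E]
  {H : Type*} [TopologicalSpace H] (I : ModelWithCorners ℝ E H)
  {N : Type*} [TopologicalSpace N] [ChartedSpace H N]

/-- The coordinate expression of the `(0,2)`-tensor field `h` in the chart at `p`. -/
def tensorInChart (h : (q : N) → TangentSpace I q →L[ℝ] TangentSpace I q →L[ℝ] ℝ) (p : N)
    (y : E) : E →L[ℝ] E →L[ℝ] ℝ :=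
  let L : E →L[ℝ] E := mfderiv 𝓘(ℝ, E) I (extChartAt I p).symm y
  let B : E →L[ℝ] E →L[ℝ] ℝ := h ((extChartAt I p).symm y)
  B.bilinearComp L L

/-- The coordinate expression of the vector field `X` in the chart at `p`. -/
def vectorInChart (X : (q : N) → TangentSpace I q) (p : N) (y : E) : E :=
  mfderiv I 𝓘(ℝ, E) (extChartAt I p) ((extChartAt I p).symm y) (X ((extChartAt I p).symm y))

/-- The Lie derivative `L_X f = df(X)` of a function. -/
def lieDerivFun (X : (q : N) → TangentSpace I q) (f : N → ℝ) (p : N) : ℝ :=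
  mfderiv I 𝓘(ℝ, ℝ) f p (X p)

/-- The Lie derivative of a `(0,2)`-tensor field, in coordinates
`(L_X h)_{ij} = X^k ∂_k h_{ij} + h_{kj} ∂_i X^k + h_{ik} ∂_j X^k`. -/
def lieDerivTensor (X : (q : N) → TangentSpace I q)
    (h : (q : N) → TangentSpace I q →L[ℝ] TangentSpace I q →L[ℝ] ℝ) (p : N) :
    TangentSpace I p →L[ℝ] TangentSpace I p →L[ℝ] ℝ :=
  let y : E := extChartAt I p p
  let h' : E → E →L[ℝ] E →L[ℝ] ℝ := tensorInChart I h p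
  let X' : E → E := vectorInChart I X p
  (fderiv ℝ h' y (X' y)
    + (h' y).bilinearComp (fderiv ℝ X' y) (ContinuousLinearMap.id ℝ E)
    + (h' y).bilinearComp (ContinuousLinearMap.id ℝ E) (fderiv ℝ X' y) : E →L[ℝ] E →L[ℝ] ℝ)

variable (g : (q : N) → TangentSpace I q →L[ℝ] TangentSpace I q →L[ℝ] ℝ)

/-- The Hessian `∇²f`. -/
def hess (f : N → ℝ) (p : N) : TangentSpace I p →L[ℝ] TangentSpace I p →L[ℝ] ℝ :=
  localHess (E := E) (tensorInChart I g p) (f ∘ (extChartAt I p).symm) (extChartAt I p p)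

/-- The squared norm `|∇f|²` of the gradient. -/
def gradSq (f : N → ℝ) (p : N) : ℝ :=
  localGradSq (E := E) (tensorInChart I g p) (f ∘ (extChartAt I p).symm) (extChartAt I p p)

variable [FiniteDimensional ℝ E]

/-- The Ricci tensor. -/
def ric (p : N) : TangentSpace I p →L[ℝ] TangentSpace I p →L[ℝ] ℝ :=
  localRic (E := E) (tensorInChart I g p) (extChartAt I p p)

/-- The scalar curvature `R = tr_g Ric`. -/
def scal (p : N) : ℝ :=
  metricTrace (E := E) (tensorInChart I g p (extChartAt I p p)) (ric I g p)

/-- The Laplacian `Δf = tr_g ∇²f`. -/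
def laplacian (f : N → ℝ) (p : N) : ℝ :=
  metricTrace (E := E) (tensorInChart I g p (extChartAt I p p)) (hess I g f p)

/-- The Bakry-Emery Ricci tensor `Ric_φ = Ric + ∇²φ`. -/
def weightedRic (φ : N → ℝ) (p : N) : TangentSpace I p →L[ℝ] TangentSpace I p →L[ℝ] ℝ :=
  ric I g p + hess I g φ p

/-- `P_φ = Ric_φ - λ g`. -/
def weightedP (φ : N → ℝ) (lam : ℝ) (p : N) :
    TangentSpace I p →L[ℝ] TangentSpace I p →L[ℝ] ℝ :=
  weightedRic I g φ p - lam • g p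

/-- `F_φ = Δφ - |∇φ|² + 2 λ φ - (dim N) λ`. -/
def weightedF (φ : N → ℝ) (lam : ℝ) (p : N) : ℝ :=
  laplacian I g φ p - gradSq I g φ p + 2 * lam * φ p - (Module.finrank ℝ E : ℝ) * lam

/-- `R_φ = R + 2 Δφ - |∇φ|² + 2 λ (φ - dim N)`. -/
def weightedScal (φ : N → ℝ) (lam : ℝ) (p : N) : ℝ :=
  scal I g p + 2 * laplacian I g φ p - gradSq I g φ p
    + 2 * lam * (φ p - (Module.finrank ℝ E : ℝ))

end Manifold

/-! ### The ambient manifold `ℝ × M × ℝ`, with points `(v, x, u)` -/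

/-- The model vector space of an `n`-dimensional manifold. -/
abbrev Model (n : ℕ) : Type := EuclideanSpace ℝ (Fin n)

/-- The model with corners of `ℝ × M × ℝ`, where `M` is an `n`-dimensional manifold. -/
abbrev ambientModel (n : ℕ) :
    ModelWithCorners ℝ (ℝ × Model n × ℝ) (ModelProd ℝ (ModelProd (Model n) ℝ)) :=
  𝓘(ℝ, ℝ).prod ((𝓡 n).prod 𝓘(ℝ, ℝ))

section Ambient

variable {n : ℕ} {M : Type*} [TopologicalSpace M] [ChartedSpace (Model n) M]

/-- A function on (a neighbourhood of `u = 0` in) `ℝ × M × ℝ` is `O(u^∞)` if it is `O(u^m)` for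
every `m`, at every point of `{u = 0}`. For a smooth function this says that all its derivatives
`∂_u^k` vanish at `u = 0`. -/
def FunIsOInf (f : ℝ × M × ℝ → ℝ) : Prop :=
  ∀ (v : ℝ) (x : M) (m : ℕ), (fun u : ℝ => f (v, x, u)) =O[𝓝 0] (fun u : ℝ => u ^ m)

/-- A `(0,2)`-tensor field on (a neighbourhood of `u = 0` in) `ℝ × M × ℝ` is `O(u^∞)` if all its
components are. The tangent space of `ℝ × M × ℝ` at `(v, x, u)` is identified with `ℝ × T_x M × ℝ`;
`a, b` are fixed vectors of the latter. -/
def TensorIsOInf (T : (p : ℝ × M × ℝ) →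
    TangentSpace (ambientModel n) p →L[ℝ] TangentSpace (ambientModel n) p →L[ℝ] ℝ) : Prop :=
  ∀ (v : ℝ) (x : M) (a b : ℝ × Model n × ℝ) (m : ℕ),
    (fun u : ℝ => T (v, x, u) a b) =O[𝓝 0] (fun u : ℝ => u ^ m)

/-- The coordinate one-form `dv`. -/
def dv (n : ℕ) : (ℝ × Model n × ℝ) →L[ℝ] ℝ := ContinuousLinearMap.fst ℝ ℝ (Model n × ℝ)

/-- The differential of the projection `ℝ × M × ℝ → M`. -/
def dx (n : ℕ) : (ℝ × Model n × ℝ) →L[ℝ] Model n :=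
  ContinuousLinearMap.fst ℝ (Model n) ℝ ∘L ContinuousLinearMap.snd ℝ ℝ (Model n × ℝ)

/-- The coordinate one-form `du`. -/
def du (n : ℕ) : (ℝ × Model n × ℝ) →L[ℝ] ℝ :=
  ContinuousLinearMap.snd ℝ (Model n) ℝ ∘L ContinuousLinearMap.snd ℝ ℝ (Model n × ℝ)

/-- A `1`-parameter family `h_u` of `(0,2)`-tensors on `M`, viewed as the tensor field
`(h_u)_{ij} dx^i dx^j` on `ℝ × M × ℝ`. -/
def horizontal (h : ℝ → (x : M) → TangentSpace (𝓡 n) x →L[ℝ] TangentSpace (𝓡 n) x →L[ℝ] ℝ)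
    (p : ℝ × M × ℝ) :
    TangentSpace (ambientModel n) p →L[ℝ] TangentSpace (ambientModel n) p →L[ℝ] ℝ :=
  let B : Model n →L[ℝ] Model n →L[ℝ] ℝ := h p.2.2 p.2.1
  B.bilinearComp (dx n) (dx n)

/-- The metric `2 du dv + g_u`. -/
def ambientMetric (g : ℝ → (x : M) → TangentSpace (𝓡 n) x →L[ℝ] TangentSpace (𝓡 n) x →L[ℝ] ℝ)
    (p : ℝ × M × ℝ) :
    TangentSpace (ambientModel n) p →L[ℝ] TangentSpace (ambientModel n) p →L[ℝ] ℝ :=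
  let B : (ℝ × Model n × ℝ) →L[ℝ] (ℝ × Model n × ℝ) →L[ℝ] ℝ := horizontal g p
  (dv n).smulRight (du n) + (du n).smulRight (dv n) + B

/-- The function `φ_u - v + λ u v`. -/
def ambientPotential (φ : ℝ → M → ℝ) (lam : ℝ) (p : ℝ × M × ℝ) : ℝ :=
  φ p.2.2 p.2.1 - p.1 + lam * p.2.2 * p.1

/-- `(v_{1,φ})_u = R_φ / 2` of `(g_u, φ_u)`, as a function of `u` and `x`. -/
def vOne (g : ℝ → (x : M) → TangentSpace (𝓡 n) x →L[ℝ] TangentSpace (𝓡 n) x →L[ℝ] ℝ)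
    (φ : ℝ → M → ℝ) (lam : ℝ) (u : ℝ) (x : M) : ℝ :=
  (1 / 2) * weightedScal (𝓡 n) (g u) (φ u) lam x

/-- The vector field `X = (v_{1,φ})_u ∂_v - ∂_u`. -/
def flowField (g : ℝ → (x : M) → TangentSpace (𝓡 n) x →L[ℝ] TangentSpace (𝓡 n) x →L[ℝ] ℝ)
    (φ : ℝ → M → ℝ) (lam : ℝ) (p : ℝ × M × ℝ) : TangentSpace (ambientModel n) p :=
  ((vOne g φ lam p.2.2 p.2.1, 0, -1) : ℝ × Model n × ℝ)

variable [IsManifold (𝓡 n) ∞ M]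

/-- A weighted ambient space in normal form for the manifold with density `(M, g₀, φ₀, λ)`:
the metric `2 du dv + g_u` and the function `φ_u - v + λ u v` on a neighbourhood of `{u = 0}` in
`ℝ × M × ℝ`, where `(g_u, φ_u)` is a smooth `1`-parameter family starting at `(g₀, φ₀)`, such that
`P_φ` and `F_φ` of the ambient metric and function are `O(u^∞)`. -/
structure NormalAmbientSpace
    (g₀ : ContMDiffRiemannianMetric (𝓡 n) ∞ (Model n) (fun x : M => TangentSpace (𝓡 n) x))
    (φ₀ : C^∞⟮𝓡 n, M; 𝓘(ℝ, ℝ), ℝ⟯) (lam : ℝ) where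
  /-- The ambient manifold is `{(v, x, u) | (x, u) ∈ W}`. -/
  W : Set (M × ℝ)
  isOpen_W : IsOpen W
  mem_W : ∀ x : M, (x, (0 : ℝ)) ∈ W
  /-- The family `g_u`; its values outside `W` are irrelevant. -/
  g : ℝ → (x : M) → TangentSpace (𝓡 n) x →L[ℝ] TangentSpace (𝓡 n) x →L[ℝ] ℝ
  /-- The family `φ_u`; its values outside `W` are irrelevant. -/
  φ : ℝ → M → ℝ
  symm : ∀ (x : M) (u : ℝ), (x, u) ∈ W → ∀ a b : TangentSpace (𝓡 n) x, g u x a b = g u x b a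
  pos : ∀ (x : M) (u : ℝ), (x, u) ∈ W → ∀ a : TangentSpace (𝓡 n) x, a ≠ 0 → 0 < g u x a a
  smooth_g : ContMDiffOn ((𝓡 n).prod 𝓘(ℝ, ℝ))
    ((𝓡 n).prod 𝓘(ℝ, Model n →L[ℝ] Model n →L[ℝ] ℝ)) ∞
    (fun p : M × ℝ => TotalSpace.mk' (Model n →L[ℝ] Model n →L[ℝ] ℝ)
      (E := fun x : M => TangentSpace (𝓡 n) x →L[ℝ] TangentSpace (𝓡 n) x →L[ℝ] ℝ)
      p.1 (g p.2 p.1)) W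
  smooth_φ : ContMDiffOn ((𝓡 n).prod 𝓘(ℝ, ℝ)) 𝓘(ℝ, ℝ) ∞ (fun p : M × ℝ => φ p.2 p.1) W
  g_zero : ∀ x : M, g 0 x = g₀.inner x
  φ_zero : ∀ x : M, φ 0 x = φ₀ x
  P_isOInf : TensorIsOInf (fun p : ℝ × M × ℝ =>
    weightedP (ambientModel n) (ambientMetric g) (ambientPotential φ lam) lam p)
  F_isOInf : FunIsOInf (fun p : ℝ × M × ℝ =>
    weightedF (ambientModel n) (ambientMetric g) (ambientPotential φ lam) lam p)

end Ambient

end WeightedAmbient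

end

/-!
Both congruences come from identities which hold exactly at every point near which `(g_u, φ_u)` is
`C²` and at which `g_u` is nondegenerate. Write `P` and `F` for the ambient tensor
`Ric + ∇²φ̃` and the ambient function `Δφ̃ - |∇φ̃|²`.

The Christoffel symbols of `2 du dv + g_u` vanish on `∂_v`, have no `∂_u`-component and do not
depend on `v`, so only horizontal vectors contribute to the trace defining the Ricci tensor, which
therefore restricts to `Ric(g_u)` on horizontal vectors. The Christoffel symbols of two horizontal
vectors have `∂_v`-component `-∂_u g_u / 2`, which enters the Hessian of `φ_u - v`. Hence, on
horizontal vectors, `P = Ric_φ - ∂_u g_u / 2`, while `L_X g_u = -∂_u g_u`, and so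
`L_X g_u + 2 Ric_φ = 2 P`. In the same way `F = Δφ_u - tr (∂_u g_u) / 2 - |∇φ_u|² + 2 ∂_u φ_u`,
and eliminating `∂_u φ_u` and `∂_u g_u` gives `L_X φ̃ + R + Δφ_u = (tr P - F) / 2`, with the trace
taken over horizontal vectors.
-/

noncomputable section

namespace WeightedAmbient

section LinearAlgebra

theorem trace_prod {R V W : Type*} [CommRing R] [AddCommGroup V] [Module R V] [Module.Free R V]
    [Module.Finite R V] [AddCommGroup W] [Module R W] [Module.Free R W] [Module.Finite R W]
    (T : V × W →ₗ[R] V × W) :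
    LinearMap.trace R (V × W) T =
      LinearMap.trace R V (LinearMap.fst R V W ∘ₗ T ∘ₗ LinearMap.inl R V W) +
        LinearMap.trace R W (LinearMap.snd R V W ∘ₗ T ∘ₗ LinearMap.inr R V W) := by
  have hT : T = (T ∘ₗ LinearMap.inl R V W) ∘ₗ LinearMap.fst R V W +
      (T ∘ₗ LinearMap.inr R V W) ∘ₗ LinearMap.snd R V W := by
    refine LinearMap.ext fun a => ?_
    simp [← map_add]
  rw [congrArg (LinearMap.trace R (V × W)) hT, map_add,
    LinearMap.trace_comp_comm' (LinearMap.fst R V W),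
    LinearMap.trace_comp_comm' (LinearMap.snd R V W)]

theorem trace_end_self {R : Type*} [CommRing R] (f : R →ₗ[R] R) : LinearMap.trace R R f = f 1 := by
  simp [LinearMap.trace_eq_matrix_trace R (Module.Basis.singleton Unit R), Matrix.trace,
    LinearMap.toMatrix_apply]

variable {E F : Type*} [NormedAddCommGroup E] [NormedSpace ℝ E] [NormedAddCommGroup F]
  [NormedSpace ℝ F]

theorem isInvertible_of_pos [FiniteDimensional ℝ E] {A : E →L[ℝ] E →L[ℝ] ℝ}
    (hA : ∀ a, a ≠ 0 → 0 < A a a) : A.IsInvertible := by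
  have hinj : Function.Injective (A : E →ₗ[ℝ] E →L[ℝ] ℝ) := by
    refine (injective_iff_map_eq_zero _).2 fun a ha => by_contra fun h => (hA a h).ne' ?_
    exact DFunLike.congr_fun ha a
  have hdim : Module.finrank ℝ E = Module.finrank ℝ (E →L[ℝ] ℝ) :=
    Subspace.dual_finrank_eq.symm.trans LinearMap.toContinuousLinearMap.finrank_eq
  exact ⟨(LinearEquiv.ofInjectiveOfFinrankEq _ hinj hdim).toContinuousLinearEquiv, by ext; rfl⟩

theorem apply_sharp {A : E →L[ℝ] E →L[ℝ] ℝ} (hA : A.IsInvertible) (l : E →L[ℝ] ℝ) :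
    A (sharp A l) = l :=
  hA.self_apply_inverse l

theorem sharp_eq_iff {A : E →L[ℝ] E →L[ℝ] ℝ} (hA : A.IsInvertible) {l : E →L[ℝ] ℝ} {a : E} :
    sharp A l = a ↔ l = A a :=
  hA.inverse_apply_eq

theorem metricTrace_add (A B C : E →L[ℝ] E →L[ℝ] ℝ) :
    metricTrace A (B + C) = metricTrace A B + metricTrace A C := by
  simp [metricTrace, ContinuousLinearMap.comp_add]

theorem metricTrace_smul (A B : E →L[ℝ] E →L[ℝ] ℝ) (r : ℝ) :
    metricTrace A (r • B) = r * metricTrace A B := by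
  simp [metricTrace]

/-- The pullback of bilinear forms along `p`, as a continuous linear map in the form. -/
def bilinearPullback (p : E →L[ℝ] F) :
    (F →L[ℝ] F →L[ℝ] ℝ) →L[ℝ] (E →L[ℝ] E →L[ℝ] ℝ) :=
  ContinuousLinearMap.precomp (E →L[ℝ] ℝ) p ∘L
    ContinuousLinearMap.postcomp F (ContinuousLinearMap.precomp ℝ p)

@[simp]
theorem bilinearPullback_apply (p : E →L[ℝ] F) (B : F →L[ℝ] F →L[ℝ] ℝ) (a b : E) :
    bilinearPullback p B a b = B (p a) (p b) := rfl

end LinearAlgebra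

section NullExtension

variable {F : Type*} [NormedAddCommGroup F] [NormedSpace ℝ F]

variable (F) in
/-- The inclusion `a ↦ (0, a, 0)` of the horizontal vectors of `ℝ × F × ℝ`. -/
def horiz : F →L[ℝ] ℝ × F × ℝ :=
  ContinuousLinearMap.inr ℝ ℝ (F × ℝ) ∘L ContinuousLinearMap.inl ℝ F ℝ

@[simp]
theorem horiz_apply (a : F) : horiz F a = (0, a, 0) := rfl

variable (F) in
/-- The projection of `ℝ × F × ℝ` onto its horizontal factor; for `F = Model n` this is `dx n`. -/
def horizProj : ℝ × F × ℝ →L[ℝ] F :=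
  ContinuousLinearMap.fst ℝ F ℝ ∘L ContinuousLinearMap.snd ℝ ℝ (F × ℝ)

@[simp]
theorem horizProj_apply (a : ℝ × F × ℝ) : horizProj F a = a.2.1 := rfl

variable (F) in
/-- The bilinear form `2 du dv` on `ℝ × F × ℝ`, with coordinates `(v, x, u)`. -/
def nullForm : ℝ × F × ℝ →L[ℝ] ℝ × F × ℝ →L[ℝ] ℝ :=
  let dv := ContinuousLinearMap.fst ℝ ℝ (F × ℝ)
  let du := ContinuousLinearMap.snd ℝ F ℝ ∘L ContinuousLinearMap.snd ℝ ℝ (F × ℝ)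
  dv.smulRight du + du.smulRight dv

/-- The bilinear form `2 du dv + B` on `ℝ × F × ℝ`. -/
def nullExtension (B : F →L[ℝ] F →L[ℝ] ℝ) : ℝ × F × ℝ →L[ℝ] ℝ × F × ℝ →L[ℝ] ℝ :=
  nullForm F + bilinearPullback (horizProj F) B

theorem nullExtension_apply (B : F →L[ℝ] F →L[ℝ] ℝ) (a b : ℝ × F × ℝ) :
    nullExtension B a b = a.1 * b.2.2 + a.2.2 * b.1 + B a.2.1 b.2.1 := by
  simp [nullExtension, nullForm]

variable {B : F →L[ℝ] F →L[ℝ] ℝ}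

theorem nullExtension_raise (hB : B.IsInvertible) (l : ℝ × F × ℝ →L[ℝ] ℝ) :
    nullExtension B (l (0, 0, 1), sharp B (l ∘L horiz F), l (1, 0, 0)) = l := by
  ext <;> simp [nullExtension_apply, apply_sharp hB, Prod.mk_zero_zero]

theorem isInvertible_nullExtension (hB : B.IsInvertible) : (nullExtension B).IsInvertible := by
  let raise : (ℝ × F × ℝ →L[ℝ] ℝ) →L[ℝ] ℝ × F × ℝ :=
    (ContinuousLinearMap.apply ℝ ℝ (0, 0, 1)).prod
      ((sharp B ∘L ContinuousLinearMap.precomp ℝ (horiz F)).prod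
        (ContinuousLinearMap.apply ℝ ℝ (1, 0, 0)))
  refine .of_inverse (g := raise) (ContinuousLinearMap.ext fun l => nullExtension_raise hB l)
    (ContinuousLinearMap.ext fun a => ?_)
  have hl : nullExtension B a ∘L horiz F = B a.2.1 := by
    ext c
    simp [nullExtension_apply]
  change (nullExtension B a (0, 0, 1), sharp B (nullExtension B a ∘L horiz F),
    nullExtension B a (1, 0, 0)) = a
  rw [hl, (sharp_eq_iff hB).2 rfl]
  simp [nullExtension_apply]

theorem sharp_nullExtension_apply (hB : B.IsInvertible) (l : ℝ × F × ℝ →L[ℝ] ℝ) :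
    sharp (nullExtension B) l = (l (0, 0, 1), sharp B (l ∘L horiz F), l (1, 0, 0)) :=
  (sharp_eq_iff (isInvertible_nullExtension hB)).2 (nullExtension_raise hB l).symm

theorem trace_eq_blocks [FiniteDimensional ℝ F] (T : ℝ × F × ℝ →L[ℝ] ℝ × F × ℝ) :
    LinearMap.trace ℝ (ℝ × F × ℝ) (T : ℝ × F × ℝ →ₗ[ℝ] ℝ × F × ℝ) =
      (T (1, 0, 0)).1
        + LinearMap.trace ℝ F ((horizProj F ∘L T ∘L horiz F : F →L[ℝ] F) : F →ₗ[ℝ] F)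
        + (T (0, 0, 1)).2.2 := by
  rw [trace_prod, trace_prod, trace_end_self, trace_end_self, ← add_assoc]
  rfl

theorem metricTrace_nullExtension [FiniteDimensional ℝ F] (hB : B.IsInvertible)
    {Q : ℝ × F × ℝ →L[ℝ] ℝ × F × ℝ →L[ℝ] ℝ}
    (hQ : Q (1, 0, 0) (0, 0, 1) = 0) (hQ' : Q (0, 0, 1) (1, 0, 0) = 0) :
    metricTrace (nullExtension B) Q = metricTrace B (bilinearPullback (horiz F) Q) := by
  simp only [metricTrace, trace_eq_blocks, ContinuousLinearMap.comp_apply,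
    sharp_nullExtension_apply hB, hQ, hQ', zero_add, add_zero]
  congr 2
  ext a
  simp only [ContinuousLinearMap.comp_apply, sharp_nullExtension_apply hB, horizProj_apply]
  rfl

end NullExtension

section Calculus

variable {E E' F G : Type*} [NormedAddCommGroup E] [NormedSpace ℝ E] [NormedAddCommGroup E']
  [NormedSpace ℝ E'] [NormedAddCommGroup F] [NormedSpace ℝ F] [NormedAddCommGroup G]
  [NormedSpace ℝ G]

theorem clm_fderiv_apply_apply {T : E → E' →L[ℝ] E' →L[ℝ] F} {y : E} (hT : DifferentiableAt ℝ T y)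
    (l : F →L[ℝ] G) (c : E) (a b : E') :
    l (fderiv ℝ T y c a b) = fderiv ℝ (fun z => l (T z a b)) y c := by
  have h := l.hasFDerivAt.comp y ((hT.hasFDerivAt.clm_apply (hasFDerivAt_const a y)).clm_apply
    (hasFDerivAt_const b y))
  rw [show fderiv ℝ (fun z => l (T z a b)) y = _ from h.fderiv]
  simp

theorem clm_fderiv_apply_eq_zero {l : F →L[ℝ] G} {f : E → F} {y : E}
    (h : ∀ᶠ z in 𝓝 y, l (f z) = 0) (c : E) : l (fderiv ℝ f y c) = 0 := by
  by_cases hf : DifferentiableAt ℝ f y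
  · have hzero : l ∘ f =ᶠ[𝓝 y] fun _ => 0 := h
    have hcomp := DFunLike.congr_fun (l.hasFDerivAt.comp y hf.hasFDerivAt).fderiv c
    simpa [hzero.fderiv_eq] using hcomp.symm
  · simp [fderiv_zero_of_not_differentiableAt hf]

theorem fderiv_apply_eq_zero_of_invariant {f : E → F} {y e : E} (h : ∀ t : ℝ, f (y + t • e) = f y) :
    fderiv ℝ f y e = 0 := by
  by_cases hf : DifferentiableAt ℝ f y
  · rw [← hf.lineDeriv_eq_fderiv, lineDeriv]
    simp [h]
  · simp [fderiv_zero_of_not_differentiableAt hf]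

theorem fderiv_comp_of_hasFDerivAt {f : F → G} {i : E → F} {L : E →L[ℝ] F} {y : E}
    (hf : DifferentiableAt ℝ f (i y)) (hi : HasFDerivAt i L y) :
    fderiv ℝ (fun z => f (i z)) y = fderiv ℝ f (i y) ∘L L :=
  (hf.hasFDerivAt.comp y hi).fderiv

theorem differentiableAt_fderiv {f : E → F} {y : E} (hf : ContDiffAt ℝ 2 f y) :
    DifferentiableAt ℝ (fderiv ℝ f) y :=
  (hf.fderiv_right (m := 1) (by norm_num)).differentiableAt (by norm_num)

theorem eventually_differentiableAt {f : E → F} {y : E} (hf : ContDiffAt ℝ 2 f y) :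
    ∀ᶠ z in 𝓝 y, DifferentiableAt ℝ f z :=
  (hf.eventually (by simp)).mono fun _ hz => hz.differentiableAt (by norm_num)

theorem fderiv_fderiv_comp_affine {f : F → G} {i : E → F} {L : E →L[ℝ] F} {y : E}
    (hf : ContDiffAt ℝ 2 f (i y)) (hi : ∀ z, HasFDerivAt i L z) (a b : E) :
    fderiv ℝ (fderiv ℝ fun z => f (i z)) y a b = fderiv ℝ (fderiv ℝ f) (i y) (L a) (L b) := by
  have hD : fderiv ℝ (fun z => f (i z)) =ᶠ[𝓝 y]
      fun z => ContinuousLinearMap.precomp G L (fderiv ℝ f (i z)) :=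
    ((hi y).continuousAt.eventually (eventually_differentiableAt hf)).mono fun z hz =>
      fderiv_comp_of_hasFDerivAt hz (hi z)
  have hDD := ((ContinuousLinearMap.precomp G L).hasFDerivAt.comp y
    ((differentiableAt_fderiv hf).hasFDerivAt.comp y (hi y))).fderiv
  rw [hD.fderiv_eq]
  exact DFunLike.congr_fun (DFunLike.congr_fun hDD a) b

/-- The derivative `∂_u f` of a family `f` of functions on `E` depending on a parameter `u`. -/
def paramDeriv (f : E × ℝ → F) (p : E × ℝ) : F :=
  fderiv ℝ f p (0, 1)

theorem fderiv_slice {f : E × ℝ → F} {p : E × ℝ} (hf : DifferentiableAt ℝ f p) (a : E) :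
    fderiv ℝ (fun x => f (x, p.2)) p.1 a = fderiv ℝ f p (a, 0) :=
  DFunLike.congr_fun (fderiv_comp_of_hasFDerivAt hf (hasFDerivAt_prodMk_left p.1 p.2)) a

theorem fderiv_fderiv_slice {f : E × ℝ → F} {p : E × ℝ} (hf : ContDiffAt ℝ 2 f p) (a b : E) :
    fderiv ℝ (fderiv ℝ fun x => f (x, p.2)) p.1 a b = fderiv ℝ (fderiv ℝ f) p (a, 0) (b, 0) :=
  fderiv_fderiv_comp_affine hf (fun z => hasFDerivAt_prodMk_left z p.2) a b

theorem fderiv_apply_prod (f : E × ℝ → F) (p a : E × ℝ) :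
    fderiv ℝ f p a = fderiv ℝ f p (a.1, 0) + a.2 • paramDeriv f p := by
  rw [paramDeriv, ← map_smul, ← map_add]
  simp

theorem hasFDerivAt_horizontalLine (v u : ℝ) (x : E) :
    HasFDerivAt (fun x' : E => ((v, x', u) : ℝ × E × ℝ)) (horiz E) x :=
  (hasFDerivAt_prodMk_right v (x, u)).comp x (hasFDerivAt_prodMk_left x u)

end Calculus

section Asymptotics

variable {α E F : Type*} [NormedAddCommGroup E] [NormedSpace ℝ E] [FiniteDimensional ℝ E]
  [NormedAddCommGroup F] [NormedSpace ℝ F] {l : Filter α} {f : α → ℝ}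

theorem isBigO_clm_of_apply {T : α → E →L[ℝ] F} (hT : ∀ a, (fun t => T t a) =O[l] f) :
    T =O[l] f := by
  obtain ⟨C, -, hC⟩ := (Module.finBasis ℝ E).exists_opNorm_le (F := F)
  have hsum : (fun t => ∑ i, ‖T t (Module.finBasis ℝ E i)‖) =O[l] f :=
    IsBigO.fun_sum fun i _ => (hT _).norm_left
  refine (IsBigO.of_bound C (.of_forall fun t => ?_)).trans hsum
  have hnonneg : 0 ≤ ∑ i, ‖T t (Module.finBasis ℝ E i)‖ := by positivity
  rw [Real.norm_of_nonneg hnonneg]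
  exact hC hnonneg fun i =>
    Finset.single_le_sum (f := fun i => ‖T t (Module.finBasis ℝ E i)‖)
      (fun _ _ => norm_nonneg _) (Finset.mem_univ i)

theorem isBigO_metricTrace {A B : α → E →L[ℝ] E →L[ℝ] ℝ} {A₀ : E →L[ℝ] E →L[ℝ] ℝ}
    (hA : Filter.Tendsto A l (𝓝 A₀)) (hA₀ : A₀.IsInvertible)
    (hB : ∀ a b, (fun t => B t a b) =O[l] f) : (fun t => metricTrace (A t) (B t)) =O[l] f := by
  have hsharp : (fun t => sharp (A t)) =O[l] fun _ => (1 : ℝ) :=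
    ((hA₀.contDiffAt_map_inverse (𝕜 := ℝ) (n := 0)).continuousAt.tendsto.comp hA).isBigO_one ℝ
  have hform : B =O[l] f := isBigO_clm_of_apply fun a => isBigO_clm_of_apply (hB a)
  have hraised : (fun t => sharp (A t) ∘L B t) =O[l] f := by
    have hnorm : (fun t => sharp (A t) ∘L B t) =O[l] fun t => ‖sharp (A t)‖ * ‖B t‖ :=
      .of_bound' (.of_forall fun t => by simpa using (sharp (A t)).opNorm_comp_le (B t))
    simpa using hnorm.trans (hsharp.norm_left.mul hform.norm_left)
  exact ((LinearMap.trace ℝ E ∘ₗ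
    ContinuousLinearMap.coeLM ℝ).toContinuousLinearMap.isBigO_comp _ l).trans hraised

end Asymptotics

section LocalGeometry

variable {E : Type*} [NormedAddCommGroup E] [NormedSpace ℝ E]
  {G G' : E → E →L[ℝ] E →L[ℝ] ℝ} {f f' : E → ℝ} {y : E}

theorem eventually_isInvertible [FiniteDimensional ℝ E] {X : Type*} [TopologicalSpace X]
    {A : X → E →L[ℝ] E →L[ℝ] ℝ} {q : X} (hA : ContinuousAt A q) (hq : (A q).IsInvertible) :
    ∀ᶠ p in 𝓝 q, (A p).IsInvertible := by
  have := FiniteDimensional.complete ℝ E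
  obtain ⟨e, he⟩ := hq
  exact hA.eventually_mem (he ▸ e.nhds)

theorem differentiableAt_christoffel [CompleteSpace E] (hG : ContDiffAt ℝ 2 G y)
    (hi : (G y).IsInvertible) : DifferentiableAt ℝ (christoffel G) y := by
  have hD : DifferentiableAt ℝ (fderiv ℝ G) y := differentiableAt_fderiv hG
  have hflip : DifferentiableAt ℝ (fun z => (fderiv ℝ G z).flip) y :=
    (ContinuousLinearMap.flipₗᵢ ℝ E E
      (E →L[ℝ] ℝ)).toContinuousLinearEquiv.differentiableAt.comp y hD
  have hfirst : DifferentiableAt ℝ (christoffelFirst G) y :=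
    ((hD.add hflip).sub ((differentiableAt_const _).clm_comp hflip)).const_smul (1 / 2 : ℝ)
  have hsharp : DifferentiableAt ℝ (fun z => sharp (G z)) y :=
    ((hi.contDiffAt_map_inverse (n := 1)).differentiableAt (by norm_num)).comp y
      (hG.differentiableAt (by norm_num))
  exact ((ContinuousLinearMap.differentiableAt _).comp y hsharp).clm_comp hfirst

theorem localHess_apply (G : E → E →L[ℝ] E →L[ℝ] ℝ) (f : E → ℝ) (y a b : E) :
    localHess G f y a b = fderiv ℝ (fderiv ℝ f) y a b - fderiv ℝ f y (christoffel G y a b) := by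
  simp [localHess]

theorem christoffel_congr (hG : G =ᶠ[𝓝 y] G') : christoffel G =ᶠ[𝓝 y] christoffel G' := by
  refine hG.eventuallyEq_nhds.mono fun z hz => ?_
  simp only [christoffel, christoffelFirst, hz.fderiv_eq, hz.self_of_nhds]

theorem localRic_congr [FiniteDimensional ℝ E] (hG : G =ᶠ[𝓝 y] G') :
    localRic G y = localRic G' y := by
  have h := christoffel_congr hG
  ext a b
  simp only [localRic_apply, curvatureEnd, h.fderiv_eq, h.self_of_nhds]

theorem localHess_congr (hG : G =ᶠ[𝓝 y] G') (hf : f =ᶠ[𝓝 y] f') :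
    localHess G f y = localHess G' f' y := by
  simp only [localHess, (christoffel_congr hG).self_of_nhds, hf.fderiv_eq, hf.fderiv.fderiv_eq]

theorem localGradSq_congr (hG : G =ᶠ[𝓝 y] G') (hf : f =ᶠ[𝓝 y] f') :
    localGradSq G f y = localGradSq G' f' y := by
  simp only [localGradSq, hG.self_of_nhds, hf.fderiv_eq]

end LocalGeometry

section NormalForm

variable {F : Type*} [NormedAddCommGroup F] [NormedSpace ℝ F]

/-- The metric `2 du dv + k_u` on `ℝ × F × ℝ`, where `k (x, u)` is `k_u` at `x`. -/
def normalFormMetric (k : F × ℝ → F →L[ℝ] F →L[ℝ] ℝ) (z : ℝ × F × ℝ) :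
    ℝ × F × ℝ →L[ℝ] ℝ × F × ℝ →L[ℝ] ℝ :=
  nullExtension (k z.2)

/-- The function `ψ_u - v` on `ℝ × F × ℝ`, where `ψ (x, u)` is `ψ_u` at `x`. -/
def normalFormPotential (ψ : F × ℝ → ℝ) (z : ℝ × F × ℝ) : ℝ :=
  ψ z.2 - z.1

variable {k : F × ℝ → F →L[ℝ] F →L[ℝ] ℝ} {ψ : F × ℝ → ℝ} {y : ℝ × F × ℝ}

theorem fderiv_normalFormMetric (hk : DifferentiableAt ℝ k y.2) (a b c : ℝ × F × ℝ) :
    fderiv ℝ (normalFormMetric k) y a b c = fderiv ℝ k y.2 a.2 b.2.1 c.2.1 := by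
  have h : HasFDerivAt (normalFormMetric k) (bilinearPullback (horizProj F) ∘L fderiv ℝ k y.2 ∘L
      ContinuousLinearMap.snd ℝ ℝ (F × ℝ)) y :=
    ((bilinearPullback _).hasFDerivAt.comp y (hk.hasFDerivAt.comp y hasFDerivAt_snd)).const_add _
  rw [h.fderiv]
  rfl

theorem contDiffAt_normalFormMetric (hk : ContDiffAt ℝ 2 k y.2) :
    ContDiffAt ℝ 2 (normalFormMetric k) y :=
  contDiffAt_const.add ((bilinearPullback _).contDiff.contDiffAt.comp y (hk.comp y contDiffAt_snd))

theorem christoffelFirst_normalFormMetric (hk : DifferentiableAt ℝ k y.2) (a b c : ℝ × F × ℝ) :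
    christoffelFirst (normalFormMetric k) y a b c =
      (1 / 2 : ℝ) * (fderiv ℝ k y.2 a.2 b.2.1 c.2.1 + fderiv ℝ k y.2 b.2 a.2.1 c.2.1
        - fderiv ℝ k y.2 c.2 a.2.1 b.2.1) := by
  simp only [christoffelFirst_apply, fderiv_normalFormMetric hk]

theorem christoffel_normalFormMetric_congr (hk : DifferentiableAt ℝ k y.2)
    {y' a b a' b' : ℝ × F × ℝ} (hy : y'.2 = y.2) (ha : a'.2 = a.2) (hb : b'.2 = b.2) :
    christoffel (normalFormMetric k) y a b = christoffel (normalFormMetric k) y' a' b' := by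
  rw [christoffel_apply, christoffel_apply, normalFormMetric, normalFormMetric, hy]
  congr 1
  refine ContinuousLinearMap.ext fun c => ?_
  simp only [christoffelFirst_normalFormMetric hk,
    christoffelFirst_normalFormMetric (hy.symm ▸ hk : DifferentiableAt ℝ k y'.2), hy, ha, hb]

theorem christoffel_normalFormMetric_vertical_left (hk : DifferentiableAt ℝ k y.2)
    (b : ℝ × F × ℝ) : christoffel (normalFormMetric k) y (1, 0, 0) b = 0 := by
  rw [christoffel_normalFormMetric_congr hk rfl (a := (1, 0, 0)) (a' := 0) rfl rfl, map_zero,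
    zero_apply]

theorem christoffel_normalFormMetric_vertical_right (hk : DifferentiableAt ℝ k y.2)
    (a : ℝ × F × ℝ) : christoffel (normalFormMetric k) y a (1, 0, 0) = 0 := by
  rw [christoffel_normalFormMetric_congr hk rfl rfl (b := (1, 0, 0)) (b' := 0) rfl, map_zero]

theorem christoffel_normalFormMetric_snd_snd (hk : DifferentiableAt ℝ k y.2)
    (hi : (k y.2).IsInvertible) (a b : ℝ × F × ℝ) :
    (christoffel (normalFormMetric k) y a b).2.2 = 0 := by
  rw [christoffel_apply, normalFormMetric, sharp_nullExtension_apply hi,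
    show christoffelFirst (normalFormMetric k) y a b (1, 0, 0) = _ from
      christoffelFirst_normalFormMetric hk a b _]
  simp [Prod.mk_zero_zero]

theorem christoffel_normalFormMetric_horiz (hk : DifferentiableAt ℝ k y.2)
    (hi : (k y.2).IsInvertible) (a b : F) :
    christoffel (normalFormMetric k) y (0, a, 0) (0, b, 0) =
      (-(1 / 2) * paramDeriv k y.2 a b, christoffel (fun x => k (x, y.2.2)) y.2.1 a b, 0) := by
  have hslice : christoffelFirst (normalFormMetric k) y (0, a, 0) (0, b, 0) ∘L horiz F =
      christoffelFirst (fun x => k (x, y.2.2)) y.2.1 a b := by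
    ext c
    rw [christoffelFirst_apply, fderiv_slice hk, fderiv_slice hk, fderiv_slice hk]
    simp [christoffelFirst_normalFormMetric hk]
  rw [christoffel_apply, christoffel_apply, normalFormMetric, sharp_nullExtension_apply hi, hslice]
  simp [christoffelFirst_normalFormMetric hk, paramDeriv, Prod.mk_zero_zero]

end NormalForm

section NormalFormCurvature

variable {F : Type*} [NormedAddCommGroup F] [NormedSpace ℝ F] [FiniteDimensional ℝ F]
  {k : F × ℝ → F →L[ℝ] F →L[ℝ] ℝ} {y : ℝ × F × ℝ}

theorem differentiableAt_christoffel_normalFormMetric (hk : ContDiffAt ℝ 2 k y.2)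
    (hi : (k y.2).IsInvertible) : DifferentiableAt ℝ (christoffel (normalFormMetric k)) y :=
  have := FiniteDimensional.complete ℝ F
  differentiableAt_christoffel (contDiffAt_normalFormMetric hk) (isInvertible_nullExtension hi)

theorem eventually_differentiableAt_and_isInvertible (hk : ContDiffAt ℝ 2 k y.2)
    (hi : (k y.2).IsInvertible) :
    ∀ᶠ z in 𝓝 y, DifferentiableAt ℝ k z.2 ∧ (k z.2).IsInvertible :=
  continuousAt_snd.eventually
    ((eventually_differentiableAt hk).and (eventually_isInvertible hk.continuousAt hi))

theorem curvatureEnd_normalFormMetric_vertical (hk : ContDiffAt ℝ 2 k y.2)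
    (hi : (k y.2).IsInvertible) (a b : ℝ × F × ℝ) :
    curvatureEnd (normalFormMetric k) y a b (1, 0, 0) = 0 := by
  have hky := hk.differentiableAt (by norm_num)
  have hinv : fderiv ℝ (christoffel (normalFormMetric k)) y (1, 0, 0) = 0 :=
    fderiv_apply_eq_zero_of_invariant fun t =>
      ContinuousLinearMap.ext fun a => ContinuousLinearMap.ext fun b => Eq.symm <|
        christoffel_normalFormMetric_congr hky (by simp [Prod.mk_zero_zero]) rfl rfl
  have hfiber : fderiv ℝ (christoffel (normalFormMetric k)) y a (1, 0, 0) b = 0 := by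
    have hzero : (fun z => christoffel (normalFormMetric k) z (1, 0, 0) b) =ᶠ[𝓝 y] fun _ => 0 :=
      (eventually_differentiableAt_and_isInvertible hk hi).mono fun z hz =>
        christoffel_normalFormMetric_vertical_left hz.1 b
    have h := clm_fderiv_apply_apply (differentiableAt_christoffel_normalFormMetric hk hi)
      (ContinuousLinearMap.id ℝ _) a (1, 0, 0) b
    simpa [hzero.fderiv_eq] using h
  simp [curvatureEnd_apply, hinv, hfiber, christoffel_normalFormMetric_vertical_left hky]

theorem curvatureEnd_normalFormMetric_snd_snd (hk : ContDiffAt ℝ 2 k y.2)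
    (hi : (k y.2).IsInvertible) (a b c : ℝ × F × ℝ) :
    (curvatureEnd (normalFormMetric k) y a b c).2.2 = 0 := by
  have hfderiv (a b c : ℝ × F × ℝ) :
      (fderiv ℝ (christoffel (normalFormMetric k)) y c a b).2.2 = 0 := by
    have hzero : (fun z => (christoffel (normalFormMetric k) z a b).2.2) =ᶠ[𝓝 y] fun _ => 0 :=
      (eventually_differentiableAt_and_isInvertible hk hi).mono fun z hz =>
        christoffel_normalFormMetric_snd_snd hz.1 hz.2 a b
    have h := clm_fderiv_apply_apply (differentiableAt_christoffel_normalFormMetric hk hi)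
      (ContinuousLinearMap.snd ℝ F ℝ ∘L ContinuousLinearMap.snd ℝ ℝ (F × ℝ)) c a b
    simpa [hzero.fderiv_eq] using h
  simp [curvatureEnd_apply, hfderiv,
    christoffel_normalFormMetric_snd_snd (hk.differentiableAt (by norm_num)) hi]

theorem fderiv_christoffel_normalFormMetric_horiz (hk : ContDiffAt ℝ 2 k y.2)
    (hi : (k y.2).IsInvertible) (a b c : F) :
    (fderiv ℝ (christoffel (normalFormMetric k)) y (0, c, 0) (0, a, 0) (0, b, 0)).2.1 =
      fderiv ℝ (christoffel fun x => k (x, y.2.2)) y.2.1 c a b := by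
  have := FiniteDimensional.complete ℝ F
  have hline := hasFDerivAt_horizontalLine y.1 y.2.2 y.2.1
  have hΓ := differentiableAt_christoffel_normalFormMetric hk hi
  have hγ : DifferentiableAt ℝ (christoffel fun x => k (x, y.2.2)) y.2.1 :=
    differentiableAt_christoffel
      (ContDiffAt.comp (g := k) y.2.1 hk (contDiffAt_id.prodMk contDiffAt_const)) hi
  have hslice : (fun x => christoffel (fun x => k (x, y.2.2)) x a b) =ᶠ[𝓝 y.2.1] fun x =>
      horizProj F (christoffel (normalFormMetric k) (y.1, x, y.2.2) (0, a, 0) (0, b, 0)) :=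
    (hline.continuousAt.eventually (eventually_differentiableAt_and_isInvertible hk hi)).mono
      fun x hx => by simp [christoffel_normalFormMetric_horiz hx.1 hx.2]
  have hdiff : DifferentiableAt ℝ
      (fun z => horizProj F (christoffel (normalFormMetric k) z (0, a, 0) (0, b, 0))) y := by
    fun_prop
  calc (fderiv ℝ (christoffel (normalFormMetric k)) y (0, c, 0) (0, a, 0) (0, b, 0)).2.1
      = fderiv ℝ (fun z => horizProj F (christoffel (normalFormMetric k) z (0, a, 0) (0, b, 0))) y
          (0, c, 0) := clm_fderiv_apply_apply hΓ (horizProj F) _ _ _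
    _ = fderiv ℝ (fun x => christoffel (fun x => k (x, y.2.2)) x a b) y.2.1 c := by
        rw [hslice.fderiv_eq]
        exact (DFunLike.congr_fun (fderiv_comp_of_hasFDerivAt hdiff hline) c).symm
    _ = fderiv ℝ (christoffel fun x => k (x, y.2.2)) y.2.1 c a b :=
        (clm_fderiv_apply_apply hγ (ContinuousLinearMap.id ℝ F) c a b).symm

theorem curvatureEnd_normalFormMetric_horiz (hk : ContDiffAt ℝ 2 k y.2)
    (hi : (k y.2).IsInvertible) (a b c : F) :
    (curvatureEnd (normalFormMetric k) y (0, a, 0) (0, b, 0) (0, c, 0)).2.1 =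
      curvatureEnd (fun x => k (x, y.2.2)) y.2.1 a b c := by
  have hky := hk.differentiableAt (by norm_num)
  have hdrop (w : ℝ) (c d : F) : christoffel (normalFormMetric k) y (0, c, 0) (w, d, 0) =
      christoffel (normalFormMetric k) y (0, c, 0) (0, d, 0) :=
    christoffel_normalFormMetric_congr hky rfl rfl rfl
  have hΓΓ (a b c : F) : (christoffel (normalFormMetric k) y (0, c, 0)
      (christoffel (normalFormMetric k) y (0, a, 0) (0, b, 0))).2.1 =
        christoffel (fun x => k (x, y.2.2)) y.2.1 c
          (christoffel (fun x => k (x, y.2.2)) y.2.1 a b) := by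
    rw [christoffel_normalFormMetric_horiz hky hi, hdrop,
      christoffel_normalFormMetric_horiz hky hi]
  simp only [curvatureEnd_apply, Prod.snd_add, Prod.snd_sub, Prod.fst_add, Prod.fst_sub,
    fderiv_christoffel_normalFormMetric_horiz hk hi, hΓΓ]

theorem localRic_normalFormMetric_horiz (hk : ContDiffAt ℝ 2 k y.2) (hi : (k y.2).IsInvertible)
    (a b : F) :
    localRic (normalFormMetric k) y (0, a, 0) (0, b, 0) =
      localRic (fun x => k (x, y.2.2)) y.2.1 a b := by
  rw [localRic_apply, localRic_apply, trace_eq_blocks,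
    curvatureEnd_normalFormMetric_vertical hk hi, curvatureEnd_normalFormMetric_snd_snd hk hi,
    Prod.fst_zero, zero_add, add_zero]
  congr 2
  ext c
  exact curvatureEnd_normalFormMetric_horiz hk hi a b c

end NormalFormCurvature

section NormalFormHessian

variable {F : Type*} [NormedAddCommGroup F] [NormedSpace ℝ F]
  {k : F × ℝ → F →L[ℝ] F →L[ℝ] ℝ} {ψ : F × ℝ → ℝ} {y : ℝ × F × ℝ}

theorem hasFDerivAt_normalFormPotential (hψ : DifferentiableAt ℝ ψ y.2) :
    HasFDerivAt (normalFormPotential ψ)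
      (fderiv ℝ ψ y.2 ∘L ContinuousLinearMap.snd ℝ ℝ (F × ℝ) - ContinuousLinearMap.fst ℝ ℝ (F × ℝ))
      y :=
  (hψ.hasFDerivAt.comp y hasFDerivAt_snd).sub hasFDerivAt_fst

theorem fderiv_normalFormPotential (hψ : DifferentiableAt ℝ ψ y.2) (a : ℝ × F × ℝ) :
    fderiv ℝ (normalFormPotential ψ) y a = fderiv ℝ ψ y.2 a.2 - a.1 :=
  DFunLike.congr_fun (hasFDerivAt_normalFormPotential hψ).fderiv a

theorem fderiv_fderiv_normalFormPotential (hψ : ContDiffAt ℝ 2 ψ y.2) (a b : ℝ × F × ℝ) :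
    fderiv ℝ (fderiv ℝ (normalFormPotential ψ)) y a b = fderiv ℝ (fderiv ℝ ψ) y.2 a.2 b.2 := by
  have hD : fderiv ℝ (normalFormPotential ψ) =ᶠ[𝓝 y] fun z =>
      fderiv ℝ (fun z : ℝ × F × ℝ => ψ z.2) z - ContinuousLinearMap.fst ℝ ℝ (F × ℝ) :=
    (continuousAt_snd.eventually (eventually_differentiableAt hψ)).mono fun z hz => by
      simp only [(hasFDerivAt_normalFormPotential hz).fderiv,
        fderiv_comp_of_hasFDerivAt hz hasFDerivAt_snd]
  rw [hD.fderiv_eq, fderiv_sub_const]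
  exact fderiv_fderiv_comp_affine hψ (fun _ => hasFDerivAt_snd) a b

theorem localHess_normalForm_horiz (hk : DifferentiableAt ℝ k y.2) (hi : (k y.2).IsInvertible)
    (hψ : ContDiffAt ℝ 2 ψ y.2) (a b : F) :
    localHess (normalFormMetric k) (normalFormPotential ψ) y (0, a, 0) (0, b, 0) =
      localHess (fun x => k (x, y.2.2)) (fun x => ψ (x, y.2.2)) y.2.1 a b
        - (1 / 2) * paramDeriv k y.2 a b := by
  have hd := hψ.differentiableAt (by norm_num)
  rw [localHess_apply, localHess_apply, fderiv_fderiv_normalFormPotential hψ,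
    fderiv_normalFormPotential hd, christoffel_normalFormMetric_horiz hk hi,
    fderiv_fderiv_slice hψ, fderiv_slice hd]
  ring

theorem localHess_normalForm_vertical_left (hk : DifferentiableAt ℝ k y.2)
    (hψ : ContDiffAt ℝ 2 ψ y.2) (b : ℝ × F × ℝ) :
    localHess (normalFormMetric k) (normalFormPotential ψ) y (1, 0, 0) b = 0 := by
  rw [localHess_apply, fderiv_fderiv_normalFormPotential hψ,
    christoffel_normalFormMetric_vertical_left hk]
  simp [Prod.mk_zero_zero]

theorem localHess_normalForm_vertical_right (hk : DifferentiableAt ℝ k y.2)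
    (hψ : ContDiffAt ℝ 2 ψ y.2) (a : ℝ × F × ℝ) :
    localHess (normalFormMetric k) (normalFormPotential ψ) y a (1, 0, 0) = 0 := by
  rw [localHess_apply, fderiv_fderiv_normalFormPotential hψ,
    christoffel_normalFormMetric_vertical_right hk]
  simp [Prod.mk_zero_zero]

theorem metricTrace_localHess_normalForm [FiniteDimensional ℝ F] (hk : DifferentiableAt ℝ k y.2)
    (hi : (k y.2).IsInvertible) (hψ : ContDiffAt ℝ 2 ψ y.2) :
    metricTrace (normalFormMetric k y)
        (localHess (normalFormMetric k) (normalFormPotential ψ) y) =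
      metricTrace (k y.2) (localHess (fun x => k (x, y.2.2)) (fun x => ψ (x, y.2.2)) y.2.1)
        - (1 / 2) * metricTrace (k y.2) (paramDeriv k y.2) := by
  have hpull : bilinearPullback (horiz F)
      (localHess (normalFormMetric k) (normalFormPotential ψ) y) =
        localHess (fun x => k (x, y.2.2)) (fun x => ψ (x, y.2.2)) y.2.1
          + (-(1 / 2) : ℝ) • paramDeriv k y.2 := by
    ext a b
    simp [localHess_normalForm_horiz hk hi hψ, sub_eq_add_neg]
  rw [normalFormMetric, metricTrace_nullExtension hi (localHess_normalForm_vertical_left hk hψ _)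
    (localHess_normalForm_vertical_right hk hψ _), hpull, metricTrace_add, metricTrace_smul]
  ring

theorem localGradSq_normalForm (hi : (k y.2).IsInvertible) (hψ : DifferentiableAt ℝ ψ y.2) :
    localGradSq (normalFormMetric k) (normalFormPotential ψ) y =
      localGradSq (fun x => k (x, y.2.2)) (fun x => ψ (x, y.2.2)) y.2.1
        - 2 * paramDeriv ψ y.2 := by
  have hslice : fderiv ℝ (normalFormPotential ψ) y ∘L horiz F =
      fderiv ℝ (fun x => ψ (x, y.2.2)) y.2.1 := by
    ext c
    simp [fderiv_slice hψ, fderiv_normalFormPotential hψ]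
  simp only [localGradSq, normalFormMetric, sharp_nullExtension_apply hi, hslice, fderiv_slice hψ,
    fderiv_normalFormPotential hψ, Prod.mk_zero_zero, map_zero, zero_sub, sub_zero]
  rw [fderiv_apply_prod, paramDeriv, smul_eq_mul]
  ring

end NormalFormHessian

section AmbientChart

variable {n : ℕ} {M : Type*} [TopologicalSpace M] [ChartedSpace (Model n) M]

theorem coe_extChartAt_ambient (p : ℝ × M × ℝ) :
    (extChartAt (ambientModel n) p : ℝ × M × ℝ → ℝ × Model n × ℝ) =
      Prod.map id (Prod.map (extChartAt (𝓡 n) p.2.1) id) := by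
  simp only [extChartAt_prod, extChartAt_model_space_eq_id]
  rfl

theorem coe_extChartAt_ambient_symm (p : ℝ × M × ℝ) :
    ((extChartAt (ambientModel n) p).symm : ℝ × Model n × ℝ → ℝ × M × ℝ) =
      Prod.map id (Prod.map (extChartAt (𝓡 n) p.2.1).symm id) := by
  simp only [extChartAt_prod, extChartAt_model_space_eq_id]
  rfl

theorem extChartAt_ambient_self (p : ℝ × M × ℝ) :
    extChartAt (ambientModel n) p p = (p.1, extChartAt (𝓡 n) p.2.1 p.2.1, p.2.2) := by
  rw [coe_extChartAt_ambient]
  rfl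

theorem eventually_mem_extChartAt_target (p : ℝ × M × ℝ) :
    ∀ᶠ y : ℝ × Model n × ℝ in 𝓝 (p.1, extChartAt (𝓡 n) p.2.1 p.2.1, p.2.2),
      y.2.1 ∈ (extChartAt (𝓡 n) p.2.1).target :=
  (horizProj (Model n)).continuous.continuousAt.eventually
    (extChartAt_target_mem_nhds (I := 𝓡 n) p.2.1)

theorem hasMFDerivAt_horizontal_prodMap {E E' H H' N N' : Type*} [NormedAddCommGroup E]
    [NormedSpace ℝ E] [TopologicalSpace H] {I : ModelWithCorners ℝ E H} [TopologicalSpace N]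
    [ChartedSpace H N] [NormedAddCommGroup E'] [NormedSpace ℝ E'] [TopologicalSpace H']
    {I' : ModelWithCorners ℝ E' H'} [TopologicalSpace N'] [ChartedSpace H' N'] {f : N → N'}
    {p : ℝ × N × ℝ} (hf : MDifferentiableAt I I' f p.2.1) :
    HasMFDerivAt (𝓘(ℝ, ℝ).prod (I.prod 𝓘(ℝ, ℝ))) (𝓘(ℝ, ℝ).prod (I'.prod 𝓘(ℝ, ℝ)))
      (Prod.map id (Prod.map f id)) p
      ((ContinuousLinearMap.id ℝ ℝ).prodMap
        ((mfderiv I I' f p.2.1 : E →L[ℝ] E').prodMap (ContinuousLinearMap.id ℝ ℝ)) :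
        (ℝ × E × ℝ) →L[ℝ] (ℝ × E' × ℝ)) := by
  have hinner : HasMFDerivAt (I.prod 𝓘(ℝ, ℝ)) (I'.prod 𝓘(ℝ, ℝ)) (Prod.map f id) p.2
      ((mfderiv I I' f p.2.1 : E →L[ℝ] E').prodMap (ContinuousLinearMap.id ℝ ℝ)) := by
    have h := hf.hasMFDerivAt.prodMap (hasMFDerivAt_id (I := 𝓘(ℝ, ℝ)) p.2.2)
    rwa [mfderiv_id] at h
  have h := (hasMFDerivAt_id (I := 𝓘(ℝ, ℝ)) p.1).prodMap hinner
  rwa [mfderiv_id, hinner.mfderiv] at h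

/-- The coordinate expression of a family of tensors in the chart at `x`, as a function of the
coordinates and of the parameter. -/
def familyInChart (g : ℝ → (x : M) → TangentSpace (𝓡 n) x →L[ℝ] TangentSpace (𝓡 n) x →L[ℝ] ℝ)
    (x : M) (q : Model n × ℝ) : Model n →L[ℝ] Model n →L[ℝ] ℝ :=
  tensorInChart (𝓡 n) (g q.2) x q.1

/-- The coordinate expression of a family of functions in the chart at `x`, as a function of the
coordinates and of the parameter. -/
def potentialInChart (φ : ℝ → M → ℝ) (x : M) (q : Model n × ℝ) : ℝ :=
  φ q.2 ((extChartAt (𝓡 n) x).symm q.1)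

theorem ambientPotential_comp_extChartAt_symm (φ : ℝ → M → ℝ) (p : ℝ × M × ℝ) :
    ambientPotential φ 0 ∘ (extChartAt (ambientModel n) p).symm =
      normalFormPotential (potentialInChart φ p.2.1) := by
  rw [coe_extChartAt_ambient_symm]
  funext z
  simp [ambientPotential, potentialInChart, normalFormPotential]

variable [IsManifold (𝓡 n) 1 M]

theorem mfderiv_extChartAt_ambient_symm (p : ℝ × M × ℝ) {y : ℝ × Model n × ℝ}
    (hy : y.2.1 ∈ (extChartAt (𝓡 n) p.2.1).target) :
    mfderiv 𝓘(ℝ, ℝ × Model n × ℝ) (ambientModel n) (extChartAt (ambientModel n) p).symm y =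
      ((ContinuousLinearMap.id ℝ ℝ).prodMap
        ((mfderiv 𝓘(ℝ, Model n) (𝓡 n) (extChartAt (𝓡 n) p.2.1).symm y.2.1 :
            Model n →L[ℝ] Model n).prodMap (ContinuousLinearMap.id ℝ ℝ)) :
        (ℝ × Model n × ℝ) →L[ℝ] (ℝ × Model n × ℝ)) := by
  have hd : MDifferentiableAt 𝓘(ℝ, Model n) (𝓡 n) (extChartAt (𝓡 n) p.2.1).symm y.2.1 := by
    have := mdifferentiableWithinAt_extChartAt_symm (I := 𝓡 n) hy
    simpa [mdifferentiableWithinAt_univ] using this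
  rw [coe_extChartAt_ambient_symm]
  have hprod := hasMFDerivAt_horizontal_prodMap (p := y) hd
  have h : HasMFDerivAt 𝓘(ℝ, ℝ × Model n × ℝ) (ambientModel n)
      (Prod.map id (Prod.map (extChartAt (𝓡 n) p.2.1).symm id)) y _ := hprod
  exact h.mfderiv

theorem mfderiv_extChartAt_ambient (p : ℝ × M × ℝ) {q : ℝ × M × ℝ}
    (hq : q.2.1 ∈ (extChartAt (𝓡 n) p.2.1).source) :
    mfderiv (ambientModel n) 𝓘(ℝ, ℝ × Model n × ℝ) (extChartAt (ambientModel n) p) q =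
      ((ContinuousLinearMap.id ℝ ℝ).prodMap
        ((mfderiv (𝓡 n) 𝓘(ℝ, Model n) (extChartAt (𝓡 n) p.2.1) q.2.1 :
            Model n →L[ℝ] Model n).prodMap (ContinuousLinearMap.id ℝ ℝ)) :
        (ℝ × Model n × ℝ) →L[ℝ] (ℝ × Model n × ℝ)) := by
  have hd : MDifferentiableAt (𝓡 n) 𝓘(ℝ, Model n) (extChartAt (𝓡 n) p.2.1) q.2.1 :=
    mdifferentiableAt_extChartAt (by simpa using hq)
  rw [coe_extChartAt_ambient]
  have hprod := hasMFDerivAt_horizontal_prodMap (p := q) hd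
  have h : HasMFDerivAt (ambientModel n) 𝓘(ℝ, ℝ × Model n × ℝ)
      (Prod.map id (Prod.map (extChartAt (𝓡 n) p.2.1) id)) q _ := hprod
  exact h.mfderiv

variable (g : ℝ → (x : M) → TangentSpace (𝓡 n) x →L[ℝ] TangentSpace (𝓡 n) x →L[ℝ] ℝ)

theorem tensorInChart_horizontal (p : ℝ × M × ℝ) {y : ℝ × Model n × ℝ}
    (hy : y.2.1 ∈ (extChartAt (𝓡 n) p.2.1).target) :
    tensorInChart (ambientModel n) (horizontal g) p y =
      bilinearPullback (horizProj (Model n)) (familyInChart g p.2.1 y.2) := by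
  unfold tensorInChart
  rw [mfderiv_extChartAt_ambient_symm p hy, coe_extChartAt_ambient_symm]
  rfl

theorem tensorInChart_ambientMetric (p : ℝ × M × ℝ) {y : ℝ × Model n × ℝ}
    (hy : y.2.1 ∈ (extChartAt (𝓡 n) p.2.1).target) :
    tensorInChart (ambientModel n) (ambientMetric g) p y =
      normalFormMetric (familyInChart g p.2.1) y := by
  unfold tensorInChart
  rw [mfderiv_extChartAt_ambient_symm p hy, coe_extChartAt_ambient_symm]
  rfl

theorem tensorInChart_ambientMetric_eventuallyEq (p : ℝ × M × ℝ) :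
    tensorInChart (ambientModel n) (ambientMetric g) p
      =ᶠ[𝓝 (p.1, extChartAt (𝓡 n) p.2.1 p.2.1, p.2.2)]
        normalFormMetric (familyInChart g p.2.1) :=
  (eventually_mem_extChartAt_target p).mono fun _ hy => tensorInChart_ambientMetric g p hy

theorem vectorInChart_flowField (φ : ℝ → M → ℝ) (lam : ℝ) (p : ℝ × M × ℝ)
    {y : ℝ × Model n × ℝ} (hy : y.2.1 ∈ (extChartAt (𝓡 n) p.2.1).target) :
    vectorInChart (ambientModel n) (flowField g φ lam) p y =
      (vOne g φ lam y.2.2 ((extChartAt (𝓡 n) p.2.1).symm y.2.1), 0, -1) := by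
  have hq : ((extChartAt (ambientModel n) p).symm y).2.1 ∈ (extChartAt (𝓡 n) p.2.1).source := by
    rw [coe_extChartAt_ambient_symm]
    exact (extChartAt (𝓡 n) p.2.1).map_target hy
  unfold vectorInChart
  rw [mfderiv_extChartAt_ambient p hq, coe_extChartAt_ambient_symm]
  refine Prod.ext rfl (Prod.ext ?_ rfl)
  exact map_zero (mfderiv (𝓡 n) 𝓘(ℝ, Model n) (extChartAt (𝓡 n) p.2.1)
    ((extChartAt (𝓡 n) p.2.1).symm y.2.1))

end AmbientChart

section ChartSmoothness

theorem contDiffAt_clm_of_apply {D E F : Type*} [NormedAddCommGroup D] [NormedSpace ℝ D]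
    [NormedAddCommGroup E] [NormedSpace ℝ E] [FiniteDimensional ℝ E] [NormedAddCommGroup F]
    [NormedSpace ℝ F] {m : ℕ∞ω} {f : D → E →L[ℝ] F} {y : D}
    (hf : ∀ a, ContDiffAt ℝ m (fun z => f z a) y) : ContDiffAt ℝ m f y := by
  let e₁ := ContinuousLinearEquiv.ofFinrankEq (𝕜 := ℝ)
    (show Module.finrank ℝ E = Module.finrank ℝ (Fin (Module.finrank ℝ E) → ℝ) by simp)
  let e₂ := (e₁.arrowCongr (1 : F ≃L[ℝ] F)).trans (ContinuousLinearEquiv.piRing (Fin _))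
  rw [← Function.id_comp f, ← e₂.symm_comp_self]
  exact e₂.symm.contDiff.contDiffAt.comp y (contDiffAt_pi.2 fun i => hf _)

variable {E H N : Type*} [NormedAddCommGroup E] [NormedSpace ℝ E] [TopologicalSpace H]
  {I : ModelWithCorners ℝ E H} [I.Boundaryless] [TopologicalSpace N] [ChartedSpace H N]

theorem mfderiv_extChartAt_symm_eq_symmL [IsManifold I 1 N] {x : N} {y : E}
    (hy : y ∈ (extChartAt I x).target) :
    (mfderiv 𝓘(ℝ, E) I (extChartAt I x).symm y : E →L[ℝ] E) =
      (trivializationAt E (TangentSpace I) x).symmL ℝ ((extChartAt I x).symm y) := by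
  have h := TangentBundle.symmL_trivializationAt (I := I) (x₀ := x)
    (x := (extChartAt I x).symm y) (by simpa using (extChartAt I x).map_target hy)
  rw [(extChartAt I x).right_inv hy, I.range_eq_univ, mfderivWithin_univ] at h
  exact h.symm

theorem contMDiffAt_mfderiv_extChartAt_symm {m : ℕ∞ω} [IsManifold I 1 N]
    [IsManifold I (m + 1) N] {x : N} {y : E} (hy : y ∈ (extChartAt I x).target) (a : E) :
    ContMDiffAt 𝓘(ℝ, E) (I.prod 𝓘(ℝ, E)) m
      (fun z => TotalSpace.mk' E (E := fun x : N => TangentSpace I x) ((extChartAt I x).symm z)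
        (mfderiv 𝓘(ℝ, E) I (extChartAt I x).symm z a)) y := by
  have : IsManifold I m N := IsManifold.of_le (n := m + 1) le_self_add
  have : ContMDiffVectorBundle m E (fun x : N => TangentSpace I x) I :=
    TangentBundle.contMDiffVectorBundle
  let e := trivializationAt E (fun x : N => TangentSpace I x) x
  have hbase {z : E} (hz : z ∈ (extChartAt I x).target) : (extChartAt I x).symm z ∈ e.baseSet := by
    simpa [e] using (extChartAt I x).map_target hz
  have hpair : ContMDiffOn 𝓘(ℝ, E) (I.prod 𝓘(ℝ, E)) m
      (fun z => ((extChartAt I x).symm z, a)) (extChartAt I x).target :=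
    (contMDiffOn_extChartAt_symm x).prodMk contMDiffOn_const
  have hsymm := (e.contMDiffOn_symm (n := m) (IB := I)).comp hpair fun z hz =>
    e.mem_target.2 (hbase hz)
  refine (hsymm.congr fun z hz => ?_).contMDiffAt ((isOpen_extChartAt_target x).mem_nhds hy)
  rw [Function.comp_apply, ← e.mk_symm (hbase hz), mfderiv_extChartAt_symm_eq_symmL hz]
  exact congrArg _ (e.symmL_apply (hbase hz) a)

theorem tensorInChart_self [IsManifold I 1 N]
    (h : (q : N) → TangentSpace I q →L[ℝ] TangentSpace I q →L[ℝ] ℝ) (p : N) :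
    tensorInChart I h p (extChartAt I p p) = (h p : E →L[ℝ] E →L[ℝ] ℝ) := by
  have hid : (mfderiv 𝓘(ℝ, E) I (extChartAt I p).symm (extChartAt I p p) : E →L[ℝ] E) =
      ContinuousLinearMap.id ℝ E := by
    have := mfderivWithin_range_extChartAt_symm (I := I) (x := p)
    rwa [I.range_eq_univ, mfderivWithin_univ] at this
  let h' : N → E →L[ℝ] E →L[ℝ] ℝ := h
  unfold tensorInChart
  rw [hid]
  exact congrArg h' (extChartAt_to_inv (I := I) p)

end ChartSmoothness

section Regularity

variable {n : ℕ} {M : Type*} [TopologicalSpace M] [ChartedSpace (Model n) M]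
  {g : ℝ → (x : M) → TangentSpace (𝓡 n) x →L[ℝ] TangentSpace (𝓡 n) x →L[ℝ] ℝ} {φ : ℝ → M → ℝ}
  {x : M} {u : ℝ} {m : ℕ∞ω}

theorem contMDiffAt_chart_symm_prod [IsManifold (𝓡 n) m M] (x : M) (u : ℝ) :
    ContMDiffAt 𝓘(ℝ, Model n × ℝ) ((𝓡 n).prod 𝓘(ℝ, ℝ)) m
      (fun q : Model n × ℝ => ((extChartAt (𝓡 n) x).symm q.1, q.2)) (extChartAt (𝓡 n) x x, u) := by
  have hsymm : ContMDiffAt 𝓘(ℝ, Model n) (𝓡 n) m (extChartAt (𝓡 n) x).symm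
      (extChartAt (𝓡 n) x x) :=
    (contMDiffOn_extChartAt_symm x).contMDiffAt (extChartAt_target_mem_nhds x)
  exact (hsymm.comp (extChartAt (𝓡 n) x x, u) contDiff_fst.contMDiff.contMDiffAt).prodMk
    contDiff_snd.contMDiff.contMDiffAt

theorem contDiffAt_potentialInChart [IsManifold (𝓡 n) m M]
    (hφ : ContMDiffAt ((𝓡 n).prod 𝓘(ℝ, ℝ)) 𝓘(ℝ, ℝ) m (fun p : M × ℝ => φ p.2 p.1) (x, u)) :
    ContDiffAt ℝ m (potentialInChart φ x) (extChartAt (𝓡 n) x x, u) := by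
  have hψ := contMDiffAt_chart_symm_prod (n := n) (m := m) x u
  rw [← extChartAt_to_inv (I := 𝓡 n) x] at hφ
  exact (ContMDiffAt.comp (extChartAt (𝓡 n) x x, u) hφ hψ).contDiffAt

theorem contDiffAt_familyInChart [IsManifold (𝓡 n) 1 M] [IsManifold (𝓡 n) (m + 1) M]
    (hg : ContMDiffAt ((𝓡 n).prod 𝓘(ℝ, ℝ))
      ((𝓡 n).prod 𝓘(ℝ, Model n →L[ℝ] Model n →L[ℝ] ℝ)) m
      (fun p : M × ℝ => TotalSpace.mk' (Model n →L[ℝ] Model n →L[ℝ] ℝ)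
        (E := fun x : M => TangentSpace (𝓡 n) x →L[ℝ] TangentSpace (𝓡 n) x →L[ℝ] ℝ)
        p.1 (g p.2 p.1)) (x, u)) :
    ContDiffAt ℝ m (familyInChart g x) (extChartAt (𝓡 n) x x, u) := by
  have : IsManifold (𝓡 n) m M := IsManifold.of_le (n := m + 1) le_self_add
  refine contDiffAt_clm_of_apply fun a => contDiffAt_clm_of_apply fun b => ?_
  have hframe (a : Model n) : ContMDiffAt 𝓘(ℝ, Model n × ℝ) ((𝓡 n).prod 𝓘(ℝ, Model n)) m
      (fun q : Model n × ℝ => TotalSpace.mk' (Model n) (E := fun x : M => TangentSpace (𝓡 n) x)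
        ((extChartAt (𝓡 n) x).symm q.1)
        (mfderiv 𝓘(ℝ, Model n) (𝓡 n) (extChartAt (𝓡 n) x).symm q.1 a))
      (extChartAt (𝓡 n) x x, u) :=
    (contMDiffAt_mfderiv_extChartAt_symm (I := 𝓡 n) (mem_extChartAt_target x) a).comp
      (extChartAt (𝓡 n) x x, u) contDiff_fst.contMDiff.contMDiffAt
  rw [← extChartAt_to_inv (I := 𝓡 n) x] at hg
  have hfamily := ContMDiffAt.comp (extChartAt (𝓡 n) x x, u) hg
    (contMDiffAt_chart_symm_prod (n := n) (m := m) x u)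
  have happly : ContMDiffAt 𝓘(ℝ, Model n × ℝ) ((𝓡 n).prod 𝓘(ℝ, ℝ)) m
      (fun q : Model n × ℝ => TotalSpace.mk' ℝ (E := Bundle.Trivial M ℝ)
        ((extChartAt (𝓡 n) x).symm q.1) (familyInChart g x q a b)) (extChartAt (𝓡 n) x x, u) := by
    apply ContMDiffAt.clm_bundle_apply₂ (F₁ := Model n) (F₂ := Model n)
      (E₁ := fun x : M => TangentSpace (𝓡 n) x) (E₂ := fun x : M => TangentSpace (𝓡 n) x)
      (𝕜 := ℝ) (F₃ := ℝ) (E₃ := Bundle.Trivial M ℝ)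
      (b := fun q : Model n × ℝ => (extChartAt (𝓡 n) x).symm q.1)
      (ψ := fun q : Model n × ℝ => g q.2 ((extChartAt (𝓡 n) x).symm q.1))
      (v := fun q => mfderiv 𝓘(ℝ, Model n) (𝓡 n) (extChartAt (𝓡 n) x).symm q.1 a)
      (w := fun q => mfderiv 𝓘(ℝ, Model n) (𝓡 n) (extChartAt (𝓡 n) x).symm q.1 b)
    · exact hfamily
    · exact hframe a
    · exact hframe b
  exact (contMDiffAt_totalSpace.1 happly).2.contDiffAt

theorem continuousAt_of_continuousAt_potentialInChart
    (h : ContinuousAt (potentialInChart φ x) (extChartAt (𝓡 n) x x, u)) :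
    ContinuousAt (fun p : M × ℝ => φ p.2 p.1) (x, u) := by
  have hcomp : ContinuousAt (fun p : M × ℝ => potentialInChart φ x (extChartAt (𝓡 n) x p.1, p.2))
      (x, u) :=
    ContinuousAt.comp (g := potentialInChart φ x) h
      (((continuousAt_extChartAt (I := 𝓡 n) x).comp (f := Prod.fst) (x := (x, u))
        continuousAt_fst).prodMk continuousAt_snd)
  have hsource : ∀ᶠ p : M × ℝ in 𝓝 (x, u), p.1 ∈ (extChartAt (𝓡 n) x).source :=
    (continuous_fst.tendsto (x, u)).eventually (extChartAt_source_mem_nhds (I := 𝓡 n) x)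
  refine hcomp.congr (hsource.mono fun p hp => ?_)
  simp only [potentialInChart, (extChartAt (𝓡 n) x).left_inv hp]

variable (g φ x u) in
/-- The family `(g_u, φ_u)` is twice continuously differentiable near the point `(x, u)`, and `g_u`
is nondegenerate at `x`. Both are expressed in the chart at `x`. -/
structure IsRegularAt : Prop where
  contDiffAt_metric : ContDiffAt ℝ 2 (familyInChart g x) (extChartAt (𝓡 n) x x, u)
  contDiffAt_potential : ContDiffAt ℝ 2 (potentialInChart φ x) (extChartAt (𝓡 n) x x, u)
  isInvertible : (familyInChart g x (extChartAt (𝓡 n) x x, u)).IsInvertible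

theorem isRegularAt_of_contMDiffAt [IsManifold (𝓡 n) 3 M]
    (hg : ContMDiffAt ((𝓡 n).prod 𝓘(ℝ, ℝ))
      ((𝓡 n).prod 𝓘(ℝ, Model n →L[ℝ] Model n →L[ℝ] ℝ)) 2
      (fun p : M × ℝ => TotalSpace.mk' (Model n →L[ℝ] Model n →L[ℝ] ℝ)
        (E := fun x : M => TangentSpace (𝓡 n) x →L[ℝ] TangentSpace (𝓡 n) x →L[ℝ] ℝ)
        p.1 (g p.2 p.1)) (x, u))
    (hφ : ContMDiffAt ((𝓡 n).prod 𝓘(ℝ, ℝ)) 𝓘(ℝ, ℝ) 2 (fun p : M × ℝ => φ p.2 p.1) (x, u))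
    (hi : (g u x : Model n →L[ℝ] Model n →L[ℝ] ℝ).IsInvertible) : IsRegularAt g φ x u where
  contDiffAt_metric :=
    have : IsManifold (𝓡 n) (2 + 1) M := ‹IsManifold (𝓡 n) 3 M›
    contDiffAt_familyInChart hg
  contDiffAt_potential := contDiffAt_potentialInChart hφ
  isInvertible := by
    rwa [familyInChart, tensorInChart_self]

theorem IsRegularAt.eventually (h : IsRegularAt g φ x u) : ∀ᶠ t in 𝓝 u, IsRegularAt g φ x t := by
  have hline : Filter.Tendsto (fun t => (extChartAt (𝓡 n) x x, t)) (𝓝 u)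
      (𝓝 (extChartAt (𝓡 n) x x, u)) := (Continuous.prodMk_right _).continuousAt
  filter_upwards [hline.eventually (h.contDiffAt_metric.eventually (by simp)),
    hline.eventually (h.contDiffAt_potential.eventually (by simp)),
    hline.eventually (eventually_isInvertible h.contDiffAt_metric.continuousAt h.isInvertible)]
    with t hk hψ hi using ⟨hk, hψ, hi⟩

theorem IsRegularAt.tendsto_metric [IsManifold (𝓡 n) 1 M] (h : IsRegularAt g φ x u) :
    Filter.Tendsto (fun t => (g t x : Model n →L[ℝ] Model n →L[ℝ] ℝ)) (𝓝 u)
      (𝓝 (g u x : Model n →L[ℝ] Model n →L[ℝ] ℝ)) := by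
  have hline : Continuous fun t : ℝ => (extChartAt (𝓡 n) x x, t) := Continuous.prodMk_right _
  have hcont := h.contDiffAt_metric.continuousAt.comp hline.continuousAt
  have hself : familyInChart g x ∘ (fun t => (extChartAt (𝓡 n) x x, t)) = fun t => g t x :=
    funext fun t => tensorInChart_self (g t) x
  rwa [hself] at hcont

end Regularity

section AmbientTensors

variable {n : ℕ} {M : Type*} [TopologicalSpace M] [ChartedSpace (Model n) M]
  {g : ℝ → (x : M) → TangentSpace (𝓡 n) x →L[ℝ] TangentSpace (𝓡 n) x →L[ℝ] ℝ} {φ : ℝ → M → ℝ}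
  {x : M} {u : ℝ}

theorem hasMFDerivAt_ambientPotential (v : ℝ)
    (hc : ContinuousAt (fun p : M × ℝ => φ p.2 p.1) (x, u))
    (hd : DifferentiableAt ℝ (potentialInChart φ x) (extChartAt (𝓡 n) x x, u)) :
    HasMFDerivAt (ambientModel n) 𝓘(ℝ, ℝ) (ambientPotential φ 0) (v, x, u)
      (fderiv ℝ (normalFormPotential (potentialInChart φ x)) (v, extChartAt (𝓡 n) x x, u)) := by
  have hcont : ContinuousAt (ambientPotential φ 0) (v, x, u) := by
    have hφ : ContinuousAt (fun p : ℝ × M × ℝ => φ p.2.2 p.2.1) (v, x, u) :=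
      ContinuousAt.comp (g := fun p : M × ℝ => φ p.2 p.1) hc continuousAt_snd
    exact (hφ.sub continuousAt_fst).add (by fun_prop)
  refine ⟨hcont, ?_⟩
  have hw : writtenInExtChartAt (ambientModel n) 𝓘(ℝ, ℝ) (v, x, u) (ambientPotential φ 0) =
      normalFormPotential (potentialInChart φ x) :=
    ambientPotential_comp_extChartAt_symm φ (v, x, u)
  rw [extChartAt_ambient_self, hw]
  have h := hasFDerivAt_normalFormPotential (y := (v, extChartAt (𝓡 n) x x, u)) hd
  exact h.differentiableAt.hasFDerivAt.hasFDerivWithinAt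

theorem lieDerivFun_flowField_ambientPotential (v lam : ℝ) (h : IsRegularAt g φ x u) :
    lieDerivFun (ambientModel n) (flowField g φ lam) (ambientPotential φ 0) (v, x, u) =
      -vOne g φ lam u x - paramDeriv (potentialInChart φ x) (extChartAt (𝓡 n) x x, u) := by
  have hd := h.contDiffAt_potential.differentiableAt (by norm_num)
  have hm := hasMFDerivAt_ambientPotential v
    (continuousAt_of_continuousAt_potentialInChart hd.continuousAt) hd
  unfold lieDerivFun
  rw [hm.mfderiv]
  refine (fderiv_normalFormPotential (y := (v, extChartAt (𝓡 n) x x, u)) hd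
    (vOne g φ lam u x, 0, -1)).trans ?_
  have hneg : ((0, -1) : Model n × ℝ) = -(0, 1) := by simp
  simp only [hneg, map_neg, paramDeriv]
  ring

variable [IsManifold (𝓡 n) 1 M]

theorem ric_ambientMetric_horiz (v : ℝ) (h : IsRegularAt g φ x u) (a b : Model n) :
    (ric (ambientModel n) (ambientMetric g) (v, x, u) :
        (ℝ × Model n × ℝ) →L[ℝ] (ℝ × Model n × ℝ) →L[ℝ] ℝ) (0, a, 0) (0, b, 0) =
      (ric (𝓡 n) (g u) x : Model n →L[ℝ] Model n →L[ℝ] ℝ) a b := by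
  unfold ric
  rw [extChartAt_ambient_self,
    localRic_congr (tensorInChart_ambientMetric_eventuallyEq g (v, x, u))]
  exact localRic_normalFormMetric_horiz (y := (v, extChartAt (𝓡 n) x x, u)) h.contDiffAt_metric
    h.isInvertible a b

theorem hess_ambientPotential (v : ℝ) :
    (hess (ambientModel n) (ambientMetric g) (ambientPotential φ 0) (v, x, u) :
        (ℝ × Model n × ℝ) →L[ℝ] (ℝ × Model n × ℝ) →L[ℝ] ℝ) =
      localHess (normalFormMetric (familyInChart g x))
        (normalFormPotential (potentialInChart φ x)) (v, extChartAt (𝓡 n) x x, u) := by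
  unfold hess
  rw [extChartAt_ambient_self, ambientPotential_comp_extChartAt_symm,
    localHess_congr (tensorInChart_ambientMetric_eventuallyEq g (v, x, u)) (.refl _ _)]

theorem hess_ambientPotential_horiz (v : ℝ) (h : IsRegularAt g φ x u) (a b : Model n) :
    (hess (ambientModel n) (ambientMetric g) (ambientPotential φ 0) (v, x, u) :
        (ℝ × Model n × ℝ) →L[ℝ] (ℝ × Model n × ℝ) →L[ℝ] ℝ) (0, a, 0) (0, b, 0) =
      (hess (𝓡 n) (g u) (φ u) x : Model n →L[ℝ] Model n →L[ℝ] ℝ) a b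
        - (1 / 2) * paramDeriv (familyInChart g x) (extChartAt (𝓡 n) x x, u) a b := by
  rw [hess_ambientPotential]
  exact localHess_normalForm_horiz (y := (v, extChartAt (𝓡 n) x x, u))
    (h.contDiffAt_metric.differentiableAt (by norm_num)) h.isInvertible h.contDiffAt_potential a b

theorem laplacian_ambientPotential (v : ℝ) (h : IsRegularAt g φ x u) :
    laplacian (ambientModel n) (ambientMetric g) (ambientPotential φ 0) (v, x, u) =
      laplacian (𝓡 n) (g u) (φ u) x
        - (1 / 2) * metricTrace (familyInChart g x (extChartAt (𝓡 n) x x, u))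
          (paramDeriv (familyInChart g x) (extChartAt (𝓡 n) x x, u)) := by
  unfold laplacian
  rw [hess_ambientPotential, extChartAt_ambient_self,
    (tensorInChart_ambientMetric_eventuallyEq g (v, x, u)).self_of_nhds]
  exact metricTrace_localHess_normalForm (y := (v, extChartAt (𝓡 n) x x, u))
    (h.contDiffAt_metric.differentiableAt (by norm_num)) h.isInvertible h.contDiffAt_potential

theorem gradSq_ambientPotential (v : ℝ) (h : IsRegularAt g φ x u) :
    gradSq (ambientModel n) (ambientMetric g) (ambientPotential φ 0) (v, x, u) =
      gradSq (𝓡 n) (g u) (φ u) x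
        - 2 * paramDeriv (potentialInChart φ x) (extChartAt (𝓡 n) x x, u) := by
  unfold gradSq
  rw [extChartAt_ambient_self, ambientPotential_comp_extChartAt_symm,
    localGradSq_congr (tensorInChart_ambientMetric_eventuallyEq g (v, x, u)) (.refl _ _)]
  exact localGradSq_normalForm (y := (v, extChartAt (𝓡 n) x x, u)) h.isInvertible
    (h.contDiffAt_potential.differentiableAt (by norm_num))

theorem weightedP_ambient_horiz (v : ℝ) (h : IsRegularAt g φ x u) (a b : Model n) :
    (weightedP (ambientModel n) (ambientMetric g) (ambientPotential φ 0) 0 (v, x, u) :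
        (ℝ × Model n × ℝ) →L[ℝ] (ℝ × Model n × ℝ) →L[ℝ] ℝ) (0, a, 0) (0, b, 0) =
      (weightedRic (𝓡 n) (g u) (φ u) x : Model n →L[ℝ] Model n →L[ℝ] ℝ) a b
        - (1 / 2) * paramDeriv (familyInChart g x) (extChartAt (𝓡 n) x x, u) a b := by
  have hsum := congrArg₂ (· + ·) (ric_ambientMetric_horiz v h a b)
    (hess_ambientPotential_horiz v h a b)
  unfold weightedP weightedRic
  rw [zero_smul, sub_zero]
  exact hsum.trans (add_sub_assoc _ _ _).symm

theorem weightedF_ambient (v : ℝ) (h : IsRegularAt g φ x u) :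
    weightedF (ambientModel n) (ambientMetric g) (ambientPotential φ 0) 0 (v, x, u) =
      laplacian (𝓡 n) (g u) (φ u) x
        - (1 / 2) * metricTrace (familyInChart g x (extChartAt (𝓡 n) x x, u))
          (paramDeriv (familyInChart g x) (extChartAt (𝓡 n) x x, u))
        - gradSq (𝓡 n) (g u) (φ u) x
        + 2 * paramDeriv (potentialInChart φ x) (extChartAt (𝓡 n) x x, u) := by
  rw [weightedF, laplacian_ambientPotential v h, gradSq_ambientPotential v h]
  ring

theorem fderiv_vectorInChart_flowField_horizontal (φ : ℝ → M → ℝ) (lam : ℝ) (p c) :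
    (fderiv ℝ (vectorInChart (ambientModel n) (flowField g φ lam) p)
      (p.1, extChartAt (𝓡 n) p.2.1 p.2.1, p.2.2) c).2.1 = 0 :=
  clm_fderiv_apply_eq_zero (l := horizProj (Model n))
    ((eventually_mem_extChartAt_target p).mono fun z hz => by
      rw [vectorInChart_flowField g φ lam p hz, horizProj_apply]) c

theorem lieDerivTensor_flowField_horizontal (v lam : ℝ) (h : IsRegularAt g φ x u)
    (a b : ℝ × Model n × ℝ) :
    (lieDerivTensor (ambientModel n) (flowField g φ lam) (horizontal g) (v, x, u) :
        (ℝ × Model n × ℝ) →L[ℝ] (ℝ × Model n × ℝ) →L[ℝ] ℝ) a b =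
      -paramDeriv (familyInChart g x) (extChartAt (𝓡 n) x x, u) a.2.1 b.2.1 := by
  set y : ℝ × Model n × ℝ := (v, extChartAt (𝓡 n) x x, u)
  let T : ℝ × Model n × ℝ → (ℝ × Model n × ℝ) →L[ℝ] (ℝ × Model n × ℝ) →L[ℝ] ℝ :=
    tensorInChart (ambientModel n) (horizontal g) (v, x, u)
  let X : ℝ × Model n × ℝ → ℝ × Model n × ℝ :=
    vectorInChart (ambientModel n) (flowField g φ lam) (v, x, u)
  have hT : T =ᶠ[𝓝 y] fun z => bilinearPullback (horizProj (Model n)) (familyInChart g x z.2) :=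
    (eventually_mem_extChartAt_target (v, x, u)).mono fun _ hz =>
      tensorInChart_horizontal g (v, x, u) hz
  have hX : X y = (vOne g φ lam u ((extChartAt (𝓡 n) x).symm (extChartAt (𝓡 n) x x)), 0, -1) :=
    vectorInChart_flowField g φ lam (v, x, u) (mem_extChartAt_target x)
  have hDX (c) : (fderiv ℝ X y c).2.1 = 0 :=
    fderiv_vectorInChart_flowField_horizontal φ lam (v, x, u) c
  have hk : DifferentiableAt ℝ (familyInChart g x) y.2 :=
    h.contDiffAt_metric.differentiableAt (by norm_num)
  have hDT : fderiv ℝ T y = bilinearPullback (horizProj (Model n)) ∘L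
      fderiv ℝ (familyInChart g x) y.2 ∘L ContinuousLinearMap.snd ℝ ℝ (Model n × ℝ) :=
    hT.fderiv_eq.trans ((bilinearPullback (horizProj (Model n))).hasFDerivAt.comp y
      (hk.hasFDerivAt.comp y hasFDerivAt_snd)).fderiv
  have hDTX : fderiv ℝ T y (X y) a b =
      -paramDeriv (familyInChart g x) (extChartAt (𝓡 n) x x, u) a.2.1 b.2.1 := by
    have hneg : ((0, -1) : Model n × ℝ) = -(0, 1) := by simp
    rw [hDT, hX]
    change fderiv ℝ (familyInChart g x) y.2 (0, -1) a.2.1 b.2.1 = _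
    rw [hneg, map_neg]
    rfl
  unfold lieDerivTensor
  rw [extChartAt_ambient_self]
  change fderiv ℝ T y (X y) a b + T y (fderiv ℝ X y a) b + T y a (fderiv ℝ X y b) = _
  rw [hDTX, hT.self_of_nhds]
  simp only [bilinearPullback_apply, horizProj_apply, hDX, map_zero, zero_apply, add_zero]

theorem lieDerivTensor_add_weightedRic_eq (v : ℝ) (h : IsRegularAt g φ x u)
    (a b : ℝ × Model n × ℝ) :
    (lieDerivTensor (ambientModel n) (flowField g φ 0) (horizontal g) (v, x, u)
        - (-2 : ℝ) • horizontal (fun u x => weightedRic (𝓡 n) (g u) (φ u) x) (v, x, u) :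
        (ℝ × Model n × ℝ) →L[ℝ] (ℝ × Model n × ℝ) →L[ℝ] ℝ) a b =
      2 * (weightedP (ambientModel n) (ambientMetric g) (ambientPotential φ 0) 0 (v, x, u) :
        (ℝ × Model n × ℝ) →L[ℝ] (ℝ × Model n × ℝ) →L[ℝ] ℝ) (0, a.2.1, 0) (0, b.2.1, 0) := by
  let Q : Model n →L[ℝ] Model n →L[ℝ] ℝ := weightedRic (𝓡 n) (g u) (φ u) x
  rw [weightedP_ambient_horiz v h]
  refine (congrArg (· - -2 * Q a.2.1 b.2.1)
    (lieDerivTensor_flowField_horizontal v 0 h a b)).trans ?_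
  change _ = 2 * (Q a.2.1 b.2.1 - _)
  ring

theorem lieDerivFun_add_scal_add_laplacian_eq (v : ℝ) (h : IsRegularAt g φ x u) :
    lieDerivFun (ambientModel n) (flowField g φ 0) (ambientPotential φ 0) (v, x, u)
        - -(scal (𝓡 n) (g u) x + laplacian (𝓡 n) (g u) (φ u) x) =
      (1 / 2) * (metricTrace (g u x : Model n →L[ℝ] Model n →L[ℝ] ℝ)
          (bilinearPullback (horiz (Model n))
            (weightedP (ambientModel n) (ambientMetric g) (ambientPotential φ 0) 0 (v, x, u)))
        - weightedF (ambientModel n) (ambientMetric g) (ambientPotential φ 0) 0 (v, x, u)) := by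
  let A : Model n →L[ℝ] Model n →L[ℝ] ℝ := familyInChart g x (extChartAt (𝓡 n) x x, u)
  let K : Model n →L[ℝ] Model n →L[ℝ] ℝ :=
    paramDeriv (familyInChart g x) (extChartAt (𝓡 n) x x, u)
  let Q : Model n →L[ℝ] Model n →L[ℝ] ℝ := weightedRic (𝓡 n) (g u) (φ u) x
  have hA : A = g u x := tensorInChart_self (g u) x
  have hQ : metricTrace A Q = scal (𝓡 n) (g u) x + laplacian (𝓡 n) (g u) (φ u) x :=
    metricTrace_add _ _ _
  have hP : bilinearPullback (horiz (Model n))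
      (weightedP (ambientModel n) (ambientMetric g) (ambientPotential φ 0) 0 (v, x, u)) =
        Q + (-1 / 2 : ℝ) • K := by
    ext a b
    refine (weightedP_ambient_horiz v h a b).trans ?_
    change Q a b - 1 / 2 * K a b = Q a b + (-1 / 2) * K a b
    ring
  rw [← hA, hP, metricTrace_add, metricTrace_smul, hQ, weightedF_ambient v h,
    lieDerivFun_flowField_ambientPotential v 0 h, vOne, weightedScal]
  ring

end AmbientTensors

end WeightedAmbient

end

open WeightedAmbient in
theorem theorem1p4_general {n : ℕ} {M : Type*} [TopologicalSpace M] [ChartedSpace (Model n) M]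
    [IsManifold (𝓡 n) 3 M]
    {g : ℝ → (x : M) → TangentSpace (𝓡 n) x →L[ℝ] TangentSpace (𝓡 n) x →L[ℝ] ℝ}
    {φ : ℝ → M → ℝ} {x : M}
    (hg : ContMDiffAt ((𝓡 n).prod 𝓘(ℝ, ℝ))
      ((𝓡 n).prod 𝓘(ℝ, Model n →L[ℝ] Model n →L[ℝ] ℝ)) 2
      (fun p : M × ℝ => TotalSpace.mk' (Model n →L[ℝ] Model n →L[ℝ] ℝ)
        (E := fun x : M => TangentSpace (𝓡 n) x →L[ℝ] TangentSpace (𝓡 n) x →L[ℝ] ℝ)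
        p.1 (g p.2 p.1)) (x, 0))
    (hφ : ContMDiffAt ((𝓡 n).prod 𝓘(ℝ, ℝ)) 𝓘(ℝ, ℝ) 2 (fun p : M × ℝ => φ p.2 p.1) (x, 0))
    (hinv : (g 0 x : Model n →L[ℝ] Model n →L[ℝ] ℝ).IsInvertible) (v : ℝ) {r : ℝ → ℝ}
    (hP : ∀ a b : Model n, (fun u : ℝ =>
      (weightedP (ambientModel n) (ambientMetric g) (ambientPotential φ 0) 0 (v, x, u) :
        (ℝ × Model n × ℝ) →L[ℝ] (ℝ × Model n × ℝ) →L[ℝ] ℝ) (0, a, 0) (0, b, 0)) =O[𝓝 0] r)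
    (hF : (fun u : ℝ =>
      weightedF (ambientModel n) (ambientMetric g) (ambientPotential φ 0) 0 (v, x, u)) =O[𝓝 0] r) :
    (∀ a b : ℝ × Model n × ℝ, (fun u : ℝ =>
      (lieDerivTensor (ambientModel n) (flowField g φ 0) (horizontal g) (v, x, u)
        - (-2 : ℝ) • horizontal (fun u x => weightedRic (𝓡 n) (g u) (φ u) x) (v, x, u) :
        (ℝ × Model n × ℝ) →L[ℝ] (ℝ × Model n × ℝ) →L[ℝ] ℝ) a b) =O[𝓝 0] r) ∧
    (fun u : ℝ =>
      lieDerivFun (ambientModel n) (flowField g φ 0) (ambientPotential φ 0) (v, x, u)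
        - -(scal (𝓡 n) (g u) x + laplacian (𝓡 n) (g u) (φ u) x)) =O[𝓝 0] r := by
  have : IsManifold (𝓡 n) 1 M := IsManifold.of_le (n := 3) (by norm_num)
  have hreg := isRegularAt_of_contMDiffAt hg hφ hinv
  refine ⟨fun a b => ?_, ?_⟩
  · exact ((hP a.2.1 b.2.1).const_mul_left 2).congr'
      (hreg.eventually.mono fun u hu => (lieDerivTensor_add_weightedRic_eq v hu a b).symm) .rfl
  · have htrace := isBigO_metricTrace hreg.tendsto_metric hinv (B := fun u =>
      bilinearPullback (horiz (Model n))
        (weightedP (ambientModel n) (ambientMetric g) (ambientPotential φ 0) 0 (v, x, u))) hP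
    exact ((htrace.sub hF).const_mul_left (1 / 2)).congr'
      (hreg.eventually.mono fun u hu => (lieDerivFun_add_scal_add_laplacian_eq v hu).symm) .rfl

open WeightedAmbient in
theorem theorem1p4 {n : ℕ} {M : Type*} [TopologicalSpace M] [ChartedSpace (Model n) M]
    [IsManifold (𝓡 n) ∞ M]
    (g₀ : ContMDiffRiemannianMetric (𝓡 n) ∞ (Model n) (fun x : M => TangentSpace (𝓡 n) x))
    (φ₀ : C^∞⟮𝓡 n, M; 𝓘(ℝ, ℝ), ℝ⟯) (A : NormalAmbientSpace g₀ φ₀ 0) :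
    TensorIsOInf (fun p : ℝ × M × ℝ =>
      lieDerivTensor (ambientModel n) (flowField A.g A.φ 0) (horizontal A.g) p
        - (-2 : ℝ) • horizontal (fun u x => weightedRic (𝓡 n) (A.g u) (A.φ u) x) p) ∧
    FunIsOInf (fun p : ℝ × M × ℝ =>
      lieDerivFun (ambientModel n) (flowField A.g A.φ 0) (ambientPotential A.φ 0) p
        - -(scal (𝓡 n) (A.g p.2.2) p.2.1
            + laplacian (𝓡 n) (A.g p.2.2) (A.φ p.2.2) p.2.1)) := by
  have : IsManifold (𝓡 n) 3 M := IsManifold.of_le (n := ∞) ENat.LEInfty.out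
  have hflow (v x m) := theorem1p4_general
    ((A.smooth_g.contMDiffAt (A.isOpen_W.mem_nhds (A.mem_W x))).of_le ENat.LEInfty.out)
    ((A.smooth_φ.contMDiffAt (A.isOpen_W.mem_nhds (A.mem_W x))).of_le ENat.LEInfty.out)
    (isInvertible_of_pos (E := Model n) (A.pos x 0 (A.mem_W x))) v
    (fun a b => A.P_isOInf v x (0, a, 0) (0, b, 0) m) (A.F_isOInf v x m)
  exact ⟨fun v x a b m => (hflow v x m).1 a b, fun v x m => (hflow v x m).2⟩
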